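/- Let $k$ be a field, and let $M\subsetneq S=k[x_1,\dots,x_n]$ and $N\subsetneq R=k[y_1,\dots,y_l]$ be proper monomial ideals with minimal monomial generators $m_1,\dots,m_r$ and $m'_1,\dots,m'_s$. Definitions. The lcm-lattice $L_M$ is the set of all least common multiples of subsets of $\{m_1,\dots,m_r\}$, ordered by divisibility; its bottom element is $1=\operatorname{lcm}(\emptyset)$. For $a\in L_M$ put $A_a=\{i : m_i \text{ divides } a\}$, and for $a\neq 1$ let $\Delta_a$ be the simplicial complex whose facets are the sets $A_b$, where $b$ runs over the elements of $L_M$ covered by $a$ (so $\Delta_{a}=\{\emptyset\}$ if $a$ is an atom). The Betti poset $B_M$ is obtained from $L_M$ by deleting all $a\ne 1$ with $\widetilde H_i(\Delta_a;k)=0$ for all $i\ge -1$; it contains $1$ and $m_1,\dots,m_r$. The same definitions apply to $N$. A minimal free resolution of $S/M$ means a finite multigraded minimal free resolution $\mathbf F$ by finitely generated multigraded free modules $F_i$, with a fixed multigraded basis of each $F_i$. The frame of $\mathbf F$ is the complex of $k$-vector spaces with fixed bases obtained by setting $x_1=\dots=x_n=1$ in the matrices of the differentials of $\mathbf F$. Let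 $\mathbb U$ be a finite complex of finite-dimensional $k$-vector spaces with fixed bases and $U_0=k$, and let the basis elements of $U_1$ be put in bijection with the minimal generators of $N$. The $N$-homogenization of $\mathbb U$ with respect to this bijection is the complex of multigraded free $R$-modules with the same ranks in which the basis element in homological degree $0$ has multidegree $1$, a basis element in homological degree $1$ has as multidegree the corresponding generator of $N$, a basis element $v$ in homological degree $i\geq 2$ has as multidegree the lcm of the multidegrees of the basis elements $u$ occurring in $\partial(v)$ with a nonzero coefficient, and each coefficient $\alpha$ of a basis element $u$ in $\partial(v)$ is replaced by $\alpha\,\frac{\operatorname{mdeg}(v)}{\operatorname{mdeg}(u)}$. Theorem. Let $f:B_M\to B_N$ be an isomorphism of posets and let $\mathbf F$ be any minimal free resolution of $S/M$. Then the multidegree of each basis element of $F_1$ lies in $B_M$, and assigning to a basis element $w$ of $F_1$ the monomial $f(\operatorname{mdeg}(w))$ is a bijection from the basis of $F_1$ onto the set of minimal generators of $N$. The $N$-homogenization of the frame of $\mathbf F$ with respect to this bijection is a minimal free resolution of $R/N$. -/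

import Mathlib

/-! Monomials of `k[x_i | i ∈ σ]` are represented by their exponent vectors `σ →₀ ℕ`:
divisibility of monomials is `≤`, the lcm is `⊔`, and the monomial `1` is `0`. -/

/-- `m 0, …, m (r-1)` are the minimal monomial generators of the ideal `M`: they generate `M`,
and none of them divides another one. -/
structure IsMinimalMonomialGenerators {k σ : Type*} [Field k] {r : ℕ}
    (M : Ideal (MvPolynomial σ k)) (m : Fin r → (σ →₀ ℕ)) : Prop where
  span_eq : M = Ideal.span (Set.range fun i => MvPolynomial.monomial (m i) (1 : k))
  not_dvd : ∀ i j, i ≠ j → ¬ m i ≤ m j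

section LcmLattice

variable {σ : Type*} {r : ℕ}

/-- The lcm-lattice: all lcm's of subsets of `{m_1, …, m_r}` (the lcm of `∅` is `1`), ordered by
divisibility. -/
def lcmLattice (m : Fin r → (σ →₀ ℕ)) : Set (σ →₀ ℕ) :=
  Set.range fun A : Finset (Fin r) => A.sup m

open Classical in
/-- The label `A_a = {i | m_i divides a}`. -/
noncomputable def lcmLabel (m : Fin r → (σ →₀ ℕ)) (a : σ →₀ ℕ) : Finset (Fin r) :=
  Finset.univ.filter fun i => m i ≤ a

/-- The simplicial complex `Δ_a` at `a ≠ 1`: its facets are the labels `A_b` of the elements `b`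
covered by `a` in the lcm-lattice. For an atom `a` this is `{∅}`, since only `1` is covered by `a`
and `A_1 = ∅`. -/
def complexAt (m : Fin r → (σ →₀ ℕ)) (a : lcmLattice m) : Set (Finset (Fin r)) :=
  {A | ∃ b : lcmLattice m, b ⋖ a ∧ A ⊆ lcmLabel m b}

end LcmLattice

section SimplicialHomology

variable (k : Type*) [Field k] {V : Type*} [LinearOrder V]

/-- The boundary map of the augmented simplicial chain complex: the face `v_0 < … < v_p` is sent to
`∑ (-1)^j {v_0, …, v_p} \ {v_j}`, and `∅` is sent to `0`. -/
noncomputable def simplicialBoundary : (Finset V →₀ k) →ₗ[k] (Finset V →₀ k) :=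
  Finsupp.linearCombination k fun A : Finset V =>
    ∑ v ∈ A, Finsupp.single (A.erase v) ((-1 : k) ^ (A.filter fun w => w < v).card)

/-- Chains of `Δ` spanned by the faces with `i` vertices (that is, of dimension `i - 1`). -/
noncomputable def simplicialChains (Δ : Set (Finset V)) (i : ℕ) : Submodule k (Finset V →₀ k) :=
  Finsupp.supported k k {A | A ∈ Δ ∧ A.card = i}

/-- Cycles of `Δ` of dimension `i - 1` (in the augmented complex). -/
noncomputable def simplicialCycles (Δ : Set (Finset V)) (i : ℕ) : Submodule k (Finset V →₀ k) :=
  simplicialChains k Δ i ⊓ LinearMap.ker (simplicialBoundary k)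

/-- Boundaries of `Δ` of dimension `i - 1`. -/
noncomputable def simplicialBoundaries (Δ : Set (Finset V)) (i : ℕ) :
    Submodule k (Finset V →₀ k) :=
  (simplicialChains k Δ (i + 1)).map (simplicialBoundary k)

/-- `H̃(Δ; k) = 0`: in every dimension `i - 1 ≥ -1`, each cycle of the augmented simplicial chain
complex of `Δ` is a boundary. -/
def ReducedHomologyVanishes (Δ : Set (Finset V)) : Prop :=
  ∀ i, simplicialCycles k Δ i ≤ simplicialBoundaries k Δ i

end SimplicialHomology

/-- The Betti poset over `k`: delete from the lcm-lattice all `a ≠ 1` such that the reduced homology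
of `Δ_a` with coefficients in `k` vanishes in all degrees. It is ordered by divisibility. -/
def bettiPoset (k : Type*) [Field k] {σ : Type*} {r : ℕ} (m : Fin r → (σ →₀ ℕ)) :
    Set (σ →₀ ℕ) :=
  {a | ∃ ha : a ∈ lcmLattice m,
    ¬ (a ≠ 0 ∧ ReducedHomologyVanishes k (complexAt m ⟨a, ha⟩))}

/-- A (finite) complex of finite dimensional `k`-vector spaces with fixed bases; `d i` is the
matrix of the differential from homological degree `i + 1` to homological degree `i`. -/
structure BasedComplex (k : Type*) [Field k] where
  rank : ℕ → ℕ
  d : ∀ i, Matrix (Fin (rank i)) (Fin (rank (i + 1))) k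
  d_comp_d : ∀ i, d i * d (i + 1) = 0
  bounded : ∃ L, ∀ i, L < i → rank i = 0

/-- A (finite) complex of finitely generated multigraded free modules over `S = k[x_i | i ∈ σ]` with
fixed multigraded bases. In homological degree `i` the module is the direct sum of the
`S(-mdeg i a)`, and `d i` is the matrix of the differential from homological degree `i + 1` to
homological degree `i`. -/
structure MultigradedComplex (k : Type*) [Field k] (σ : Type*) where
  rank : ℕ → ℕ
  mdeg : ∀ i, Fin (rank i) → (σ →₀ ℕ)
  d : ∀ i, Matrix (Fin (rank i)) (Fin (rank (i + 1))) (MvPolynomial σ k)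
  /-- The differentials are multigraded of degree zero. -/
  multigraded : ∀ i a b, ∀ e ∈ (d i a b).support, mdeg i a + e = mdeg (i + 1) b
  d_comp_d : ∀ i, d i * d (i + 1) = 0
  bounded : ∃ L, ∀ i, L < i → rank i = 0

/-- `F` is a multigraded minimal free resolution of `S/M`. -/
structure MultigradedComplex.IsMinimalFreeResolution {k : Type*} [Field k] {σ : Type*}
    (F : MultigradedComplex k σ) (M : Ideal (MvPolynomial σ k)) : Prop where
  /-- Exactness in positive homological degrees. -/
  exact : ∀ i, Function.Exact (F.d (i + 1)).mulVecLin (F.d i).mulVecLin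
  /-- The cokernel of `F_1 → F_0` is `S/M`, through a multigraded augmentation `F_0 → S/M`. -/
  augmentation : ∃ ε : (Fin (F.rank 0) → MvPolynomial σ k) →ₗ[MvPolynomial σ k]
      (MvPolynomial σ k ⧸ M),
    Function.Surjective ε ∧ Function.Exact (F.d 0).mulVecLin ε ∧
    ∀ a, ∃ c : k, ε (Pi.single a 1) =
      Ideal.Quotient.mk M (MvPolynomial.monomial (F.mdeg 0 a) c)
  /-- Minimality: the entries of the differentials are in the ideal generated by the variables. -/
  minimal : ∀ i a b, MvPolynomial.constantCoeff (F.d i a b) = 0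

/-- The frame of `F`: set all variables equal to `1` in the matrices of the differentials. -/
noncomputable def MultigradedComplex.frame {k : Type*} [Field k] {σ : Type*}
    (F : MultigradedComplex k σ) : BasedComplex k where
  rank := F.rank
  d i := (F.d i).map (MvPolynomial.eval fun _ => (1 : k))
  d_comp_d i := by
    rw [← Matrix.map_mul, F.d_comp_d i]
    ext a b
    simp
  bounded := F.bounded

namespace BasedComplex

variable {k : Type*} [Field k] {σ : Type*}

open Classical in
/-- The multidegrees in the homogenization: `1` in homological degree `0`, the prescribed monomial
`g j` for the `j`-th basis element in homological degree `1`, and in higher homological degrees the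
lcm of the multidegrees of the basis elements that occur in the differential. -/
noncomputable def homogenizationDegree (U : BasedComplex k) (g : Fin (U.rank 1) → (σ →₀ ℕ)) :
    ∀ i, Fin (U.rank i) → (σ →₀ ℕ)
  | 0, _ => 0
  | 1, j => g j
  | i + 2, j => (Finset.univ.filter fun a => U.d (i + 1) a j ≠ 0).sup
      fun a => homogenizationDegree U g (i + 1) a

theorem homogenizationDegree_le (U : BasedComplex k) (g : Fin (U.rank 1) → (σ →₀ ℕ)) (i : ℕ)
    (a : Fin (U.rank i)) (b : Fin (U.rank (i + 1))) (h : U.d i a b ≠ 0) :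
    U.homogenizationDegree g i a ≤ U.homogenizationDegree g (i + 1) b := by
  classical
  match i with
  | 0 => simp [homogenizationDegree]
  | i + 1 =>
    conv_rhs => rw [homogenizationDegree]
    exact Finset.le_sup (f := fun a => U.homogenizationDegree g (i + 1) a) (by simpa using h)

/-- The homogenization of a complex `U` of `k`-vector spaces with `U_0 = k`, with respect to
monomials `g j` indexed by the basis of `U_1`. If the `g j` are the minimal generators of a monomial
ideal `N` (each occurring once), it is the `N`-homogenization of `U`. A coefficient `c` of the basis
element `a` in the differential of the basis element `b` becomes `c * (mdeg b / mdeg a)`. -/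
noncomputable def homogenization (U : BasedComplex k) (g : Fin (U.rank 1) → (σ →₀ ℕ)) :
    MultigradedComplex k σ where
  rank := U.rank
  mdeg := U.homogenizationDegree g
  d i := Matrix.of fun a b => MvPolynomial.monomial
    (U.homogenizationDegree g (i + 1) b - U.homogenizationDegree g i a) (U.d i a b)
  multigraded i a b e he := by
    classical
    rw [Matrix.of_apply, MvPolynomial.support_monomial] at he
    split_ifs at he with h
    · simp at he
    · rw [Finset.mem_singleton] at he
      rw [he, add_tsub_cancel_of_le (U.homogenizationDegree_le g i a b h)]
  d_comp_d i := by
    ext1 a c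
    have key : ∀ b, MvPolynomial.monomial
          (U.homogenizationDegree g (i + 1) b - U.homogenizationDegree g i a) (U.d i a b) *
        MvPolynomial.monomial (U.homogenizationDegree g (i + 1 + 1) c -
          U.homogenizationDegree g (i + 1) b) (U.d (i + 1) b c) =
        MvPolynomial.monomial (U.homogenizationDegree g (i + 1 + 1) c -
          U.homogenizationDegree g i a) (U.d i a b * U.d (i + 1) b c) := by
      intro b
      rw [MvPolynomial.monomial_mul]
      by_cases h1 : U.d i a b = 0
      · simp [h1]
      by_cases h2 : U.d (i + 1) b c = 0
      · simp [h2]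
      rw [add_comm, tsub_add_tsub_cancel (U.homogenizationDegree_le g (i + 1) b c h2)
        (U.homogenizationDegree_le g i a b h1)]
    have h := congrFun (congrFun (U.d_comp_d i) a) c
    rw [Matrix.mul_apply] at h
    simp only [Matrix.mul_apply, Matrix.of_apply, key]
    rw [← map_sum, h]
    simp
  bounded := U.bounded

end BasedComplex

/-! ### Comparison of complexes filtered by a poset -/

/-- A complex of `k`-vector spaces with a basis `I` graded by the homological degree `gr` and by
elements `deg` of a preordered set, such that the differential does not raise `deg`. -/
structure PosetGradedComplex (k : Type*) [Field k] (P : Type*) [Preorder P] where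
  I : Type
  gr : I → ℕ
  deg : I → P
  d : (I →₀ k) →ₗ[k] (I →₀ k)
  d_single_mem : ∀ x, d (Finsupp.single x 1) ∈
    Finsupp.supported k k {y | gr y + 1 = gr x ∧ deg y ≤ deg x}
  d_d : ∀ z, d (d z) = 0

namespace PosetGradedComplex

variable {k : Type*} [Field k] {P : Type*} [Preorder P]

/-- Chains of homological degree `i` with degrees in `J`. -/
def chains (X : PosetGradedComplex k P) (J : Set P) (i : ℕ) : Submodule k (X.I →₀ k) :=
  Finsupp.supported k k {x | X.gr x = i ∧ X.deg x ∈ J}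

/-- Exactness in positive homological degrees of the part of the complex with degrees in `J`. -/
def ExactOn (X : PosetGradedComplex k P) (J : Set P) : Prop :=
  ∀ i, ∀ z ∈ X.chains J (i + 1), X.d z = 0 → ∃ w ∈ X.chains J (i + 2), X.d w = z

variable {X Y : PosetGradedComplex k P}

theorem chains_mono {J J' : Set P} (h : J ⊆ J') (i : ℕ) : X.chains J i ≤ X.chains J' i :=
  Finsupp.supported_mono fun _ hx => ⟨hx.1, h hx.2⟩

theorem single_mem_chains {J : Set P} {x : X.I} (hx : X.deg x ∈ J) (c : k) :
    Finsupp.single x c ∈ X.chains J (X.gr x) :=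
  Finsupp.single_mem_supported k c ⟨rfl, hx⟩

theorem chains_induction {J : Set P} {i : ℕ} (W : Submodule k (X.I →₀ k))
    (h : ∀ x, X.gr x = i → X.deg x ∈ J → Finsupp.single x 1 ∈ W) : X.chains J i ≤ W := by
  rw [chains, Finsupp.supported_eq_span_single, Submodule.span_le]
  rintro _ ⟨x, hx, rfl⟩
  exact h x hx.1 hx.2

theorem d_single_mem_chains {x : X.I} {i : ℕ} (hx : X.gr x = i + 1) :
    X.d (Finsupp.single x 1) ∈ X.chains (Set.Iic (X.deg x)) i :=
  Finsupp.supported_mono (fun y (hy : X.gr y + 1 = X.gr x ∧ X.deg y ≤ X.deg x) =>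
    show X.gr y = i ∧ X.deg y ≤ X.deg x from ⟨by have := hy.1; omega, hy.2⟩) (X.d_single_mem x)

theorem d_single_eq_zero {x : X.I} (hx : X.gr x = 0) : X.d (Finsupp.single x 1) = 0 := by
  have h := X.d_single_mem x
  have he : {y | X.gr y + 1 = X.gr x ∧ X.deg y ≤ X.deg x} = ∅ := by
    ext y; simp [hx]
  rw [he, Finsupp.supported_empty] at h
  simpa using h

/-- On basis elements of homological degree at most `N` with degrees in `J`, the map `θ` raises the
homological degree by `s`, does not raise the degrees, and satisfies `d θ = ρ + ε θ d`. -/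
def IsLift (ρ θ : (X.I →₀ k) →ₗ[k] (Y.I →₀ k)) (ε : k) (s : ℕ) (J : Set P) (N : ℕ) : Prop :=
  ∀ x, X.deg x ∈ J → X.gr x ≤ N →
    θ (Finsupp.single x 1) ∈ Y.chains (Set.Iic (X.deg x)) (X.gr x + s) ∧
    Y.d (θ (Finsupp.single x 1)) = ρ (Finsupp.single x 1) + ε • θ (X.d (Finsupp.single x 1))

theorem IsLift.map_mem {ρ θ : (X.I →₀ k) →ₗ[k] (Y.I →₀ k)} {ε : k} {s : ℕ} {J : Set P} {N : ℕ}
    (h : IsLift ρ θ ε s J N) {J' : Set P} (hJ' : IsLowerSet J') (hJJ : J' ⊆ J) {i : ℕ} (hi : i ≤ N)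
    {z : X.I →₀ k} (hz : z ∈ X.chains J' i) : θ z ∈ Y.chains J' (i + s) := by
  refine chains_induction (W := (Y.chains J' (i + s)).comap θ) (fun x hx hxJ => ?_) hz
  subst hx
  exact chains_mono (fun e he => hJ' he hxJ) _ (h x (hJJ hxJ) hi).1

theorem IsLift.d_apply {ρ θ : (X.I →₀ k) →ₗ[k] (Y.I →₀ k)} {ε : k} {s : ℕ} {J : Set P} {N : ℕ}
    (h : IsLift ρ θ ε s J N) {i : ℕ} (hi : i ≤ N)
    {z : X.I →₀ k} (hz : z ∈ X.chains J i) : Y.d (θ z) = ρ z + ε • θ (X.d z) := by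
  refine chains_induction (W := LinearMap.eqLocus (Y.d ∘ₗ θ) (ρ + ε • (θ ∘ₗ X.d)))
    (fun x hx hxJ => ?_) hz
  subst hx
  exact (h x hxJ hi).2

/-- The inductive step shared by chain maps (`ρ = 0`, `ε = 1`, `s = 0`) and homotopies (`ε = -1`, `s
= 1`). The prescribed value `ρ x + ε θ (d x)` is a cycle by the last condition in `hρ`, and it is
lifted inside degrees at most `deg x`. The bound `1 ≤ n + s` places that cycle in positive
homological degree, where exactness is available. -/
theorem IsLift.extend {ρ θ : (X.I →₀ k) →ₗ[k] (Y.I →₀ k)} {ε : k} {s : ℕ} {J : Set P} {n : ℕ}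
    (hJ : IsLowerSet J) (h : IsLift ρ θ ε s J n) (hns : 1 ≤ n + s)
    (hY : ∀ e ∈ J, Y.ExactOn (Set.Iic e))
    (hρ : ∀ x, X.deg x ∈ J → X.gr x = n + 1 →
      ρ (Finsupp.single x 1) ∈ Y.chains (Set.Iic (X.deg x)) (n + s) ∧
      Y.d (ρ (Finsupp.single x 1)) + ε • ρ (X.d (Finsupp.single x 1)) = 0) :
    ∃ θ' : (X.I →₀ k) →ₗ[k] (Y.I →₀ k), IsLift ρ θ' ε s J (n + 1) ∧
      ∀ x, X.gr x ≤ n → θ' (Finsupp.single x 1) = θ (Finsupp.single x 1) := by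
  classical
  have hex : ∀ x, X.deg x ∈ J → X.gr x = n + 1 → ∃ w ∈ Y.chains (Set.Iic (X.deg x)) (n + 1 + s),
      Y.d w = ρ (Finsupp.single x 1) + ε • θ (X.d (Finsupp.single x 1)) := by
    intro x hx hxn
    obtain ⟨j, hj⟩ : ∃ j, n + s = j + 1 := ⟨n + s - 1, by omega⟩
    have hj2 : n + 1 + s = j + 2 := by omega
    have hd := d_single_mem_chains hxn
    have hlow : Set.Iic (X.deg x) ⊆ J := fun e he => hJ he hx
    rw [hj2]
    refine hY _ hx j _ ?_ ?_
    · rw [← hj]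
      exact add_mem (hρ x hx hxn).1
        (Submodule.smul_mem _ _ (h.map_mem (isLowerSet_Iic _) hlow le_rfl hd))
    · rw [map_add, map_smul, h.d_apply le_rfl (chains_mono hlow _ hd), X.d_d, map_zero, smul_zero,
        add_zero, (hρ x hx hxn).2]
  choose! w hw hdw using hex
  let θ' : (X.I →₀ k) →ₗ[k] (Y.I →₀ k) := Finsupp.linearCombination k fun x =>
    if X.gr x ≤ n then θ (Finsupp.single x 1) else w x
  have hs : ∀ x, θ' (Finsupp.single x 1) =
      if X.gr x ≤ n then θ (Finsupp.single x 1) else w x := fun x => by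
    simp [θ']
  have hθ : ∀ i ≤ n, ∀ z ∈ X.chains J i, θ' z = θ z := by
    intro i hi z hz
    refine chains_induction (W := LinearMap.eqLocus θ' θ) (fun x hx hxJ => ?_) hz
    rw [LinearMap.mem_eqLocus, hs, if_pos (hx.trans_le hi)]
  have hdθ : ∀ x, X.deg x ∈ J → X.gr x ≤ n + 1 →
      θ' (X.d (Finsupp.single x 1)) = θ (X.d (Finsupp.single x 1)) := by
    intro x hx hxn
    rcases Nat.eq_zero_or_pos (X.gr x) with h0 | h0
    · rw [d_single_eq_zero h0, map_zero, map_zero]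
    · obtain ⟨i, hi⟩ := Nat.exists_eq_succ_of_ne_zero h0.ne'
      exact hθ i (by omega) _
        (chains_mono (fun e he => hJ he hx) _ (d_single_mem_chains hi))
  refine ⟨θ', fun x hx hxn => ?_, fun x hx => by rw [hs, if_pos hx]⟩
  rw [hdθ x hx hxn, hs]
  split_ifs with hle
  · exact h x hx hle
  · have hgr : X.gr x = n + 1 := by omega
    rw [hgr]
    exact ⟨hw x hx hgr, hdw x hx hgr⟩

/-- The basis element `o` is the only one of homological degree `0`, and it is a boundary in the
part of degree at most `e` if there is a basis element of homological degree `1` and degree at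
most `e` in `X`. -/
structure IsOrigin (X Y : PosetGradedComplex k P) (o : Y.I) (J : Set P) : Prop where
  gr_eq_zero : Y.gr o = 0
  eq_of_gr : ∀ y, Y.gr y = 0 → y = o
  deg_le : ∀ e, Y.deg o ≤ e
  bounds : ∀ x, X.gr x = 1 → X.deg x ∈ J →
    ∃ w ∈ Y.chains (Set.Iic (X.deg x)) 1, Y.d w = Finsupp.single o 1

theorem chains_zero_eq {o : Y.I} {J J' : Set P} (ho : IsOrigin X Y o J) {z : Y.I →₀ k}
    (hz : z ∈ Y.chains J' 0) : z = Finsupp.single o (z o) := by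
  classical
  ext y
  by_cases hy : y = o
  · subst hy; simp
  · rw [Finsupp.single_eq_of_ne hy]
    by_contra hne
    exact hy (ho.eq_of_gr y (hz (by simpa using hne)).1)

/-- The comparison map `X → Y`, up to homological degree `N`. -/
theorem exists_chainMap {J : Set P} (hJ : IsLowerSet J) {oX : X.I} {oY : Y.I}
    (hX : IsOrigin Y X oX J) (hY : IsOrigin X Y oY J)
    (hex : ∀ e ∈ J, Y.ExactOn (Set.Iic e)) (N : ℕ) :
    ∃ φ : (X.I →₀ k) →ₗ[k] (Y.I →₀ k),
      IsLift 0 φ 1 0 J (N + 1) ∧ φ (Finsupp.single oX 1) = Finsupp.single oY 1 := by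
  classical
  induction N with
  | succ N ih =>
    obtain ⟨φ, hφ, hφo⟩ := ih
    obtain ⟨φ', hφ', hext⟩ := hφ.extend hJ (by omega) hex (fun x _ _ => by simp)
    exact ⟨φ', hφ', by rw [hext _ (by rw [hX.gr_eq_zero]; omega), hφo]⟩
  | zero =>
    -- Degree `1` belongs to the base case, since exactness says nothing in homological degree `0`.
    -- There `d x` is a multiple of `oX`, and `x` goes to the same multiple of a chain bounding
    -- `oY`.
    choose! w hw hdw using hY.bounds
    let φ : (X.I →₀ k) →ₗ[k] (Y.I →₀ k) := Finsupp.linearCombination k fun x =>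
      if X.gr x = 0 then Finsupp.single oY 1 else (X.d (Finsupp.single x 1) oX) • w x
    have hs : ∀ x, φ (Finsupp.single x 1) =
        if X.gr x = 0 then Finsupp.single oY 1 else (X.d (Finsupp.single x 1) oX) • w x :=
      fun x => by simp [φ]
    have ho : φ (Finsupp.single oX 1) = Finsupp.single oY 1 := by
      rw [hs, if_pos hX.gr_eq_zero]
    refine ⟨φ, fun x hx hxn => ?_, ho⟩
    rcases Nat.le_one_iff_eq_zero_or_eq_one.1 hxn with h0 | h1
    · rw [d_single_eq_zero h0, hs, if_pos h0, h0]
      refine ⟨?_, ?_⟩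
      · exact Finsupp.single_mem_supported k _ ⟨hY.gr_eq_zero, hY.deg_le _⟩
      · simp [d_single_eq_zero hY.gr_eq_zero]
    · have hd := d_single_mem_chains (X := X) (i := 0) h1
      have hd' := chains_zero_eq hX hd
      rw [hs, if_neg (by omega), h1]
      refine ⟨Submodule.smul_mem _ _ (hw x h1 hx), ?_⟩
      rw [map_smul, hdw x h1 hx]
      conv_rhs => rw [hd', ← mul_one (X.d (Finsupp.single x 1) oX), ← smul_eq_mul,
        ← Finsupp.smul_single, map_smul, ho]
      rw [LinearMap.zero_apply, zero_add, one_smul]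

/-- If two complexes are exact in positive homological degrees below each element of a lower set
`J`, and agree in homological degree `0`, then one of them is exact on `J` if the other one is. -/
theorem exactOn_of_exactOn {J : Set P} (hJ : IsLowerSet J) {oX : X.I} {oY : Y.I}
    (hoX : IsOrigin Y X oX J) (hoY : IsOrigin X Y oY J)
    (hX : ∀ e ∈ J, X.ExactOn (Set.Iic e)) (hY : ∀ e ∈ J, Y.ExactOn (Set.Iic e))
    (h : Y.ExactOn J) : X.ExactOn J := by
  intro i z hz hdz
  obtain ⟨φ, hφ, hφo⟩ := exists_chainMap hJ hoX hoY hY (i + 1)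
  obtain ⟨ψ, hψ, hψo⟩ := exists_chainMap hJ hoY hoX hX (i + 1)
  have hφm : ∀ {J' : Set P}, IsLowerSet J' → J' ⊆ J → ∀ {j}, j ≤ i + 2 →
      ∀ {y}, y ∈ X.chains J' j → φ y ∈ Y.chains J' j :=
    fun h1 h2 _ h3 _ h4 => hφ.map_mem h1 h2 h3 h4
  have hψm : ∀ {J' : Set P}, IsLowerSet J' → J' ⊆ J → ∀ {j}, j ≤ i + 2 →
      ∀ {y}, y ∈ Y.chains J' j → ψ y ∈ X.chains J' j :=
    fun h1 h2 _ h3 _ h4 => hψ.map_mem h1 h2 h3 h4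
  have hφd : ∀ {j}, j ≤ i + 2 → ∀ {y}, y ∈ X.chains J j → Y.d (φ y) = φ (X.d y) :=
    fun h1 _ h2 => by simpa using hφ.d_apply h1 h2
  have hψd : ∀ {j}, j ≤ i + 2 → ∀ {y}, y ∈ Y.chains J j → X.d (ψ y) = ψ (Y.d y) :=
    fun h1 _ h2 => by simpa using hψ.d_apply h1 h2
  let ρ : (X.I →₀ k) →ₗ[k] (X.I →₀ k) := LinearMap.id - ψ ∘ₗ φ
  -- A homotopy `d θ + θ d = id - ψ φ`; it can start with `θ = 0` because `ψ φ` fixes the origin.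
  have hhom : ∀ n ≤ i + 2, ∃ θ : (X.I →₀ k) →ₗ[k] (X.I →₀ k), IsLift ρ θ (-1) 1 J n := by
    intro n
    induction n with
    | zero =>
      refine fun _ => ⟨0, fun x _ hx => ⟨by simp, ?_⟩⟩
      obtain rfl := hoX.eq_of_gr x (by omega)
      simp [ρ, hφo, hψo]
    | succ n ih =>
      intro hn
      obtain ⟨θ, hθ⟩ := ih (by omega)
      obtain ⟨θ', hθ', -⟩ := hθ.extend hJ (by omega) hX (fun x hx hxn => by
        have hlow : Set.Iic (X.deg x) ⊆ J := fun e he => hJ he hx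
        have hm := single_mem_chains (J := Set.Iic (X.deg x)) (x := x) le_rfl (1 : k)
        rw [hxn] at hm
        have hm' := hφm (isLowerSet_Iic _) hlow hn hm
        refine ⟨sub_mem hm (hψm (isLowerSet_Iic _) hlow hn hm'), ?_⟩
        simp only [ρ, LinearMap.sub_apply, LinearMap.id_apply, LinearMap.comp_apply, map_sub]
        rw [hψd hn (chains_mono hlow _ hm'), hφd hn (chains_mono hlow _ hm)]
        simp)
      exact ⟨θ', hθ'⟩
  obtain ⟨θ, hθ⟩ := hhom (i + 1) (by omega)
  obtain ⟨w, hw, hdw⟩ := h i (φ z) (hφm hJ subset_rfl (by omega) hz)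
    (by rw [hφd (by omega) hz, hdz, map_zero])
  -- Since `d z = 0`, the homotopy gives `d (θ z) = z - ψ φ z`, while `d (ψ w) = ψ φ z`.
  refine ⟨θ z + ψ w, add_mem (hθ.map_mem hJ subset_rfl le_rfl hz)
    (hψm hJ subset_rfl le_rfl hw), ?_⟩
  rw [map_add, hθ.d_apply le_rfl hz, hψd le_rfl hw, hdw, hdz]
  simp [ρ]

end PosetGradedComplex

/-! ### The simplex and its cone contraction -/

section Simplex

variable (k : Type*) [Field k] {V : Type*} [LinearOrder V]

theorem simplicialBoundary_single (A : Finset V) :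
    simplicialBoundary k (Finsupp.single A 1) =
      ∑ v ∈ A, Finsupp.single (A.erase v) ((-1 : k) ^ (A.filter fun w => w < v).card) := by
  simp [simplicialBoundary]

/-- The cone operator with apex `v`: it sends a face `A` to `insert v A` if `v ∉ A`, and to `0`
otherwise. -/
noncomputable def coneOperator (v : V) : (Finset V →₀ k) →ₗ[k] (Finset V →₀ k) :=
  Finsupp.linearCombination k fun A : Finset V =>
    if v ∈ A then 0 else Finsupp.single (insert v A) 1

theorem coneOperator_single_of_notMem {v : V} {A : Finset V} (h : v ∉ A) (c : k) :
    coneOperator k v (Finsupp.single A c) = Finsupp.single (insert v A) c := by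
  simp [coneOperator, h]

theorem coneOperator_single_of_mem {v : V} {A : Finset V} (h : v ∈ A) (c : k) :
    coneOperator k v (Finsupp.single A c) = 0 := by
  simp [coneOperator, h]

/-- As `v` precedes every vertex of `A`, removing it has sign `+1`, and its presence flips the sign
of every other term once. -/
theorem simplicialBoundary_insert {v : V} {A : Finset V} (h : ∀ w ∈ A, v < w) :
    simplicialBoundary k (Finsupp.single (insert v A) 1) =
      Finsupp.single A 1 - coneOperator k v (simplicialBoundary k (Finsupp.single A 1)) := by
  have hv : v ∉ A := fun hv => lt_irrefl v (h v hv)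
  rw [simplicialBoundary_single, simplicialBoundary_single, Finset.sum_insert hv, map_sum,
    sub_eq_add_neg, ← Finset.sum_neg_distrib]
  congr 1
  · have : (insert v A).filter (fun w => w < v) = ∅ := by
      ext w
      simp only [Finset.mem_filter, Finset.mem_insert, Finset.notMem_empty, iff_false, not_and]
      rintro (rfl | hw)
      · exact lt_irrefl _
      · exact (h w hw).not_gt
    rw [this, Finset.erase_insert hv]
    simp
  · refine Finset.sum_congr rfl fun w hw => ?_
    have hvw : v < w := h w hw
    rw [coneOperator_single_of_notMem k (fun h' => hv (Finset.mem_of_mem_erase h')),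
      Finset.erase_insert_of_ne hvw.ne, Finset.filter_insert, if_pos hvw,
      Finset.card_insert_of_notMem (fun h' => hv (Finset.mem_of_mem_filter _ h')), pow_succ,
      mul_neg_one, Finsupp.single_neg]

theorem simplicialBoundary_coneOperator_add {v : V} {A : Finset V} (h : ∀ w ∈ A, v ≤ w) :
    simplicialBoundary k (coneOperator k v (Finsupp.single A 1)) +
      coneOperator k v (simplicialBoundary k (Finsupp.single A 1)) = Finsupp.single A 1 := by
  by_cases hv : v ∈ A
  · rw [coneOperator_single_of_mem k hv, map_zero, zero_add]
    have hA : ∀ w ∈ A.erase v, v < w := fun w hw =>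
      lt_of_le_of_ne (h w (Finset.mem_of_mem_erase hw)) (Finset.ne_of_mem_erase hw).symm
    conv_lhs => rw [← Finset.insert_erase hv, simplicialBoundary_insert k hA, map_sub,
      coneOperator_single_of_notMem k (Finset.notMem_erase v A), Finset.insert_erase hv,
      simplicialBoundary_single]
    rw [map_sum, map_sum, Finset.sum_eq_zero, sub_zero]
    intro w hw
    rw [coneOperator_single_of_notMem k
      (fun h' => Finset.notMem_erase v A (Finset.mem_of_mem_erase h')),
      coneOperator_single_of_mem k (Finset.mem_insert_self _ _)]
  · have hA : ∀ w ∈ A, v < w := fun w hw => lt_of_le_of_ne (h w hw) (fun e => hv (e ▸ hw))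
    rw [coneOperator_single_of_notMem k hv, simplicialBoundary_insert k hA, sub_add_cancel]

theorem simplicialBoundary_mem_supported (A : Finset V) :
    simplicialBoundary k (Finsupp.single A 1) ∈
      Finsupp.supported k k {B | B.card + 1 = A.card ∧ B ⊆ A} := by
  rw [simplicialBoundary_single]
  exact Submodule.sum_mem _ fun v hv => Finsupp.single_mem_supported k _
    ⟨Finset.card_erase_add_one hv, Finset.erase_subset v A⟩

theorem simplicialBoundary_coneOperator_add_of_supported {v : V} {z : Finset V →₀ k}
    (hz : z ∈ Finsupp.supported k k {A : Finset V | ∀ w ∈ A, v ≤ w}) :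
    simplicialBoundary k (coneOperator k v z) + coneOperator k v (simplicialBoundary k z) = z := by
  revert z
  suffices Finsupp.supported k k {A : Finset V | ∀ w ∈ A, v ≤ w} ≤ LinearMap.eqLocus
      (simplicialBoundary k ∘ₗ coneOperator k v + coneOperator k v ∘ₗ simplicialBoundary k)
      LinearMap.id from fun z hz => this hz
  rw [Finsupp.supported_eq_span_single, Submodule.span_le]
  rintro _ ⟨A, hA, rfl⟩
  exact simplicialBoundary_coneOperator_add k hA

/-- Adding vertices from the left reduces the claim to the cone identity: `d (insert v A) = A - c (d
A)`, and `d (c (d A)) = d A` once `d (d A) = 0`. -/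
theorem simplicialBoundary_simplicialBoundary (z : Finset V →₀ k) :
    simplicialBoundary k (simplicialBoundary k z) = 0 := by
  suffices simplicialBoundary k ∘ₗ simplicialBoundary k = (0 : (Finset V →₀ k) →ₗ[k] _) from
    LinearMap.congr_fun this z
  refine Finsupp.lhom_ext' fun A => LinearMap.ext_ring ?_
  simp only [LinearMap.comp_apply, Finsupp.lsingle_apply, LinearMap.zero_apply]
  induction A using Finset.induction_on_min with
  | empty => simp [simplicialBoundary_single]
  | insert v A hA ih =>
    have hs : simplicialBoundary k (Finsupp.single A 1) ∈
        Finsupp.supported k k {B : Finset V | ∀ w ∈ B, v ≤ w} :=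
      Finsupp.supported_mono
        (show {B : Finset V | B.card + 1 = A.card ∧ B ⊆ A} ⊆ {B | ∀ w ∈ B, v ≤ w} from
          fun B hB w hw => (hA w (hB.2 hw)).le)
        (simplicialBoundary_mem_supported k A)
    have h := simplicialBoundary_coneOperator_add_of_supported k hs
    rw [ih, map_zero, add_zero] at h
    rw [simplicialBoundary_insert k hA, map_sub, h, sub_self]

end Simplex

/-! ### The Taylor complex and the Betti poset -/

section Taylor

variable (k : Type*) [Field k] {σ : Type*} {r : ℕ} (m : Fin r → (σ →₀ ℕ))

/-- The frame of the Taylor complex: its basis consists of the subsets of the set of generators,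
each with the lcm of its elements as degree. -/
noncomputable def taylorComplex : PosetGradedComplex k (σ →₀ ℕ) where
  I := Finset (Fin r)
  gr := Finset.card
  deg A := A.sup m
  d := simplicialBoundary k
  d_single_mem A := Finsupp.supported_mono
    (show {B : Finset (Fin r) | B.card + 1 = A.card ∧ B ⊆ A} ⊆
      {B | B.card + 1 = A.card ∧ B.sup m ≤ A.sup m} from
        fun _ hB => ⟨hB.1, Finset.sup_mono hB.2⟩)
    (simplicialBoundary_mem_supported k A)
  d_d := simplicialBoundary_simplicialBoundary k

/-- The span of the subsets with `i` elements that have their lcm in `J`. -/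
noncomputable def taylorChains (J : Set (σ →₀ ℕ)) (i : ℕ) : Submodule k (Finset (Fin r) →₀ k) :=
  Finsupp.supported k k {A | A.card = i ∧ A.sup m ∈ J}

theorem taylorComplex_exactOn_iff (J : Set (σ →₀ ℕ)) : (taylorComplex k m).ExactOn J ↔
    ∀ i, ∀ z ∈ taylorChains k m J (i + 1), simplicialBoundary k z = 0 →
      ∃ w ∈ taylorChains k m J (i + 2), simplicialBoundary k w = z :=
  Iff.rfl

/-- The sets with lcm dividing `e` form a full simplex on the generators dividing `e`. It is
contracted by the cone over its least vertex; with no such generator there are no chains in positive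
degree. -/
theorem taylorComplex_exactOn_Iic (e : σ →₀ ℕ) : (taylorComplex k m).ExactOn (Set.Iic e) := by
  classical
  rw [taylorComplex_exactOn_iff]
  intro i z hz hdz
  by_cases hv : ∃ v, m v ≤ e ∧ ∀ w, m w ≤ e → v ≤ w
  · obtain ⟨v, hve, hv⟩ := hv
    have hsub : {A : Finset (Fin r) | A.card = i + 1 ∧ A.sup m ∈ Set.Iic e} ⊆
        {A | ∀ w ∈ A, v ≤ w} := fun A hA w hw => hv w ((Finset.le_sup hw).trans hA.2)
    have hz' := Finsupp.supported_mono (M := k) (R := k) hsub hz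
    refine ⟨coneOperator k v z, ?_, ?_⟩
    · have hle : taylorChains k m (Set.Iic e) (i + 1) ≤
          (taylorChains k m (Set.Iic e) (i + 2)).comap (coneOperator k v) := by
        conv_lhs => rw [taylorChains, Finsupp.supported_eq_span_single]
        rw [Submodule.span_le]
        rintro _ ⟨A, ⟨hA, hAe⟩, rfl⟩
        simp only [SetLike.mem_coe, Submodule.mem_comap]
        by_cases hvA : v ∈ A
        · rw [coneOperator_single_of_mem k hvA]; exact zero_mem _
        · rw [coneOperator_single_of_notMem k hvA]
          refine Finsupp.single_mem_supported k _ ⟨?_, ?_⟩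
          · rw [Finset.card_insert_of_notMem hvA, hA]
          · rw [Finset.sup_insert]
            exact sup_le hve hAe
      exact hle hz
    · have h := simplicialBoundary_coneOperator_add_of_supported k hz'
      rwa [hdz, map_zero, add_zero] at h
  · have hno : ∀ w, ¬ m w ≤ e := by
      intro w hw
      obtain ⟨v, hv1, hv2⟩ := WellFounded.has_min (wellFounded_lt (α := Fin r))
        {w | m w ≤ e} ⟨w, hw⟩
      exact hv ⟨v, hv1, fun u hu => not_lt.1 (hv2 u hu)⟩
    refine ⟨0, zero_mem _, ?_⟩
    rw [map_zero]
    symm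
    ext A
    by_contra hne
    obtain ⟨hA1, hA2⟩ := hz (show A ∈ (z.support : Set _) by simpa using hne)
    obtain ⟨w, hw⟩ := Finset.card_pos.1 (show 0 < A.card by omega)
    exact hno w ((Finset.le_sup hw).trans hA2)

variable {m}

instance finite_lcmLattice : Finite (lcmLattice m) := by
  unfold lcmLattice
  infer_instance

theorem mem_complexAt_iff {a : σ →₀ ℕ} (ha : a ∈ lcmLattice m) {A : Finset (Fin r)} :
    A ∈ complexAt m ⟨a, ha⟩ ↔ A.sup m < a := by
  constructor
  · rintro ⟨b, hb, hA⟩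
    refine lt_of_le_of_lt (Finset.sup_le fun i hi => ?_) (show (b : σ →₀ ℕ) < a from hb.lt)
    simpa [lcmLabel] using hA hi
  · intro h
    let c : lcmLattice m := ⟨A.sup m, A, rfl⟩
    obtain ⟨b, hcb, hb⟩ := exists_le_covBy_of_lt (show c < ⟨a, ha⟩ from h)
    refine ⟨b, hb, fun i hi => ?_⟩
    simpa [lcmLabel] using (Finset.le_sup hi).trans (show A.sup m ≤ b from hcb)

variable {k}

theorem zero_mem_bettiPoset : (0 : σ →₀ ℕ) ∈ bettiPoset k m :=
  ⟨⟨∅, Finset.sup_empty⟩, by simp⟩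

/-- A vertex of the complex at `m i` would be a generator properly dividing `m i`. So `∅` is a cycle
of dimension `-1` that bounds nothing. -/
theorem generator_mem_bettiPoset (hm : ∀ i j, i ≠ j → ¬ m i ≤ m j) (i : Fin r) :
    m i ∈ bettiPoset k m := by
  classical
  have hL : m i ∈ lcmLattice m := ⟨{i}, Finset.sup_singleton⟩
  refine ⟨hL, ?_⟩
  rintro ⟨h0, hv⟩
  have hlt : (0 : σ →₀ ℕ) < m i := pos_iff_ne_zero.2 h0
  have hmem : (Finsupp.single ∅ 1 : Finset (Fin r) →₀ k) ∈
      simplicialCycles k (complexAt m ⟨m i, hL⟩) 0 := by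
    refine ⟨Finsupp.single_mem_supported k _ ⟨?_, rfl⟩, ?_⟩
    · rw [mem_complexAt_iff]
      exact hlt
    · simp [simplicialBoundary_single]
  obtain ⟨w, hw, hdw⟩ := hv 0 hmem
  have hw0 : w = 0 := by
    ext A
    by_contra hne
    obtain ⟨hA1, hA2⟩ := hw (show A ∈ (w.support : Set _) by simpa using hne)
    rw [mem_complexAt_iff] at hA1
    obtain ⟨j, rfl⟩ := Finset.card_eq_one.1 hA2
    rw [Finset.sup_singleton] at hA1
    exact hm j i (fun h => hA1.ne (h ▸ rfl)) hA1.le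
  rw [hw0, map_zero] at hdw
  simpa using (DFunLike.congr_fun hdw ∅).symm

/-- For `e` in the lcm-lattice the chains below `e` are those of `Δ_e`, which is acyclic. Otherwise
no set has lcm equal to `e`, so `< e` and `≤ e` give the same chains. -/
theorem taylorComplex_exactOn_Iio {e : σ →₀ ℕ} (he : e ∉ bettiPoset k m) :
    (taylorComplex k m).ExactOn (Set.Iio e) := by
  by_cases hL : e ∈ lcmLattice m
  · have hv : e ≠ 0 ∧ ReducedHomologyVanishes k (complexAt m ⟨e, hL⟩) := by
      by_contra h
      exact he ⟨hL, h⟩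
    have hc : ∀ i, taylorChains k m (Set.Iio e) i =
        simplicialChains k (complexAt m ⟨e, hL⟩) i := by
      intro i
      unfold taylorChains simplicialChains
      congr 1
      ext A
      simp only [Set.mem_ofPred_eq, Set.mem_Iio]
      rw [mem_complexAt_iff, and_comm]
    rw [taylorComplex_exactOn_iff]
    intro i z hz hdz
    rw [hc] at hz
    obtain ⟨w, hw, hdw⟩ := hv.2 (i + 1) ⟨hz, hdz⟩
    exact ⟨w, by rw [hc]; exact hw, hdw⟩
  · have hc : ∀ i, taylorChains k m (Set.Iio e) i = taylorChains k m (Set.Iic e) i := by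
      intro i
      unfold taylorChains
      congr 1
      ext A
      simp only [Set.mem_ofPred_eq, Set.mem_Iio, Set.mem_Iic]
      exact and_congr_right fun _ => ⟨le_of_lt, fun h => lt_of_le_of_ne h fun h' => hL ⟨A, h'⟩⟩
    have h := taylorComplex_exactOn_Iic k m e
    rw [taylorComplex_exactOn_iff] at h ⊢
    simpa only [hc] using h

end Taylor

/-! ### Multigraded strands of homogeneous matrices -/

section HomogeneousMatrix

variable {k : Type*} [Field k] {σ : Type*} {p q t : Type*}

/-- The matrix of the multigraded map between free modules with basis elements of degrees `α a` and
`β b` that becomes `A` when all variables are set to `1`. -/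
noncomputable def homogeneousMatrix (α : p → (σ →₀ ℕ)) (β : q → (σ →₀ ℕ)) (A : Matrix p q k) :
    Matrix p q (MvPolynomial σ k) :=
  Matrix.of fun a b => MvPolynomial.monomial (β b - α a) (A a b)

/-- The homogeneous element of degree `e` of the free module with basis elements of degrees `α a`
that becomes `x` when all variables are set to `1`. -/
noncomputable def homogeneousVector (α : p → (σ →₀ ℕ)) (e : σ →₀ ℕ) (x : p → k) :
    p → MvPolynomial σ k :=
  fun a => MvPolynomial.monomial (e - α a) (x a)

open Classical in
/-- The component of degree `e` of an element of the free module with basis elements of degrees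
`α a`, with all variables set to `1`. -/
noncomputable def homogeneousComponentAt (α : p → (σ →₀ ℕ)) (e : σ →₀ ℕ)
    (v : p → MvPolynomial σ k) : p → k :=
  fun a => if α a ≤ e then (v a).coeff (e - α a) else 0

theorem homogeneousComponentAt_le (α : p → (σ →₀ ℕ)) (e : σ →₀ ℕ) (v : p → MvPolynomial σ k)
    (a : p) (h : homogeneousComponentAt α e v a ≠ 0) : α a ≤ e := by
  by_contra hle
  exact h (if_neg hle)

theorem homogeneousComponentAt_homogeneousVector (α : p → (σ →₀ ℕ)) (e : σ →₀ ℕ) (x : p → k)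
    (hx : ∀ a, x a ≠ 0 → α a ≤ e) :
    homogeneousComponentAt α e (homogeneousVector α e x) = x := by
  classical
  ext a
  unfold homogeneousComponentAt homogeneousVector
  split_ifs with h
  · rw [MvPolynomial.coeff_monomial, if_pos rfl]
  · by_contra h'
    exact h (hx a (Ne.symm h'))

variable [Fintype q]

theorem homogeneousMatrix_mulVec_homogeneousVector {α : p → (σ →₀ ℕ)} {β : q → (σ →₀ ℕ)}
    {A : Matrix p q k} (hA : ∀ a b, A a b ≠ 0 → α a ≤ β b) (e : σ →₀ ℕ) {x : q → k}
    (hx : ∀ b, x b ≠ 0 → β b ≤ e) :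
    (homogeneousMatrix α β A).mulVec (homogeneousVector β e x) =
      homogeneousVector α e (A.mulVec x) := by
  ext1 a
  simp only [Matrix.mulVec, dotProduct, homogeneousVector, map_sum]
  refine Finset.sum_congr rfl fun b _ => ?_
  rw [homogeneousMatrix, Matrix.of_apply, MvPolynomial.monomial_mul]
  by_cases h1 : A a b = 0
  · simp [h1]
  by_cases h2 : x b = 0
  · simp [h2]
  rw [add_comm, tsub_add_tsub_cancel (hx b h2) (hA a b h1)]

theorem homogeneousComponentAt_mulVec {α : p → (σ →₀ ℕ)} {β : q → (σ →₀ ℕ)}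
    {A : Matrix p q k} (hA : ∀ a b, A a b ≠ 0 → α a ≤ β b) (e : σ →₀ ℕ)
    (v : q → MvPolynomial σ k) :
    homogeneousComponentAt α e ((homogeneousMatrix α β A).mulVec v) =
      A.mulVec (homogeneousComponentAt β e v) := by
  classical
  ext a
  simp only [homogeneousComponentAt, Matrix.mulVec, dotProduct, homogeneousMatrix, Matrix.of_apply]
  split_ifs with ha
  · rw [MvPolynomial.coeff_sum]
    refine Finset.sum_congr rfl fun b _ => ?_
    rw [MvPolynomial.coeff_monomial_mul']
    by_cases h1 : A a b = 0
    · simp [h1]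
    have hab := hA a b h1
    by_cases hb : β b ≤ e
    · rw [if_pos hb, if_pos (tsub_le_tsub_right hb _), tsub_tsub_tsub_cancel_right hab]
    · rw [if_neg hb, if_neg, mul_zero]
      intro h
      apply hb
      rwa [tsub_le_tsub_iff_right ha] at h
  · symm
    refine Finset.sum_eq_zero fun b _ => ?_
    by_cases h1 : A a b = 0
    · simp [h1]
    rw [if_neg (fun hb => ha ((hA a b h1).trans hb)), mul_zero]

/-- Only finitely many degrees `u + β b`, with `u` in the support of `v b`, contribute; this lets
equations be solved strand by strand. -/
theorem sum_homogeneousVector (β : q → (σ →₀ ℕ)) (v : q → MvPolynomial σ k) :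
    ∃ S : Finset (σ →₀ ℕ),
      v = ∑ e ∈ S, homogeneousVector β e (homogeneousComponentAt β e v) := by
  classical
  refine ⟨Finset.univ.biUnion fun b => (v b).support.image fun u => u + β b, ?_⟩
  ext b u
  rw [Finset.sum_apply, MvPolynomial.coeff_sum, Finset.sum_eq_single (u + β b)]
  · simp [homogeneousVector, homogeneousComponentAt]
  · intro e _ he
    by_cases hb : β b ≤ e
    · rw [homogeneousVector, MvPolynomial.coeff_monomial, if_neg]
      rintro rfl
      exact he (tsub_add_cancel_of_le hb).symm
    · simp [homogeneousVector, homogeneousComponentAt, hb]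
  · intro h
    have : (v b).coeff u = 0 := by
      by_contra hne
      refine h (Finset.mem_biUnion.2 ⟨b, Finset.mem_univ _, Finset.mem_image.2 ⟨u, ?_, rfl⟩⟩)
      simpa using hne
    simp [homogeneousVector, homogeneousComponentAt, this]

/-- Exactness of a multigraded complex can be tested degree by degree after setting all variables to
`1`. -/
theorem exact_homogeneousMatrix_iff [Fintype t] {α : p → (σ →₀ ℕ)} {β : q → (σ →₀ ℕ)}
    {γ : t → (σ →₀ ℕ)} {A : Matrix p q k} {B : Matrix q t k}
    (hA : ∀ a b, A a b ≠ 0 → α a ≤ β b) (hB : ∀ a b, B a b ≠ 0 → β a ≤ γ b) (hAB : A * B = 0) :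
    Function.Exact (homogeneousMatrix β γ B).mulVecLin (homogeneousMatrix α β A).mulVecLin ↔
      ∀ e, ∀ x : q → k, (∀ b, x b ≠ 0 → β b ≤ e) → A.mulVec x = 0 →
        ∃ y : t → k, (∀ c, y c ≠ 0 → γ c ≤ e) ∧ B.mulVec y = x := by
  constructor
  · intro h e x hx hAx
    have hker : (homogeneousMatrix α β A).mulVecLin (homogeneousVector β e x) = 0 := by
      rw [Matrix.mulVecLin_apply, homogeneousMatrix_mulVec_homogeneousVector hA e hx, hAx]
      ext1 a
      simp [homogeneousVector]
    obtain ⟨v, hv⟩ := (h _).1 hker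
    refine ⟨homogeneousComponentAt γ e v, homogeneousComponentAt_le γ e v, ?_⟩
    rw [← homogeneousComponentAt_mulVec hB, ← Matrix.mulVecLin_apply, hv,
      homogeneousComponentAt_homogeneousVector β e x hx]
  · intro h v
    constructor
    · intro hv
      have hcomp : ∀ e, A.mulVec (homogeneousComponentAt β e v) = 0 := by
        intro e
        rw [← homogeneousComponentAt_mulVec hA, ← Matrix.mulVecLin_apply, hv]
        ext a
        simp [homogeneousComponentAt]
      choose y hy hBy using fun e => h e _ (homogeneousComponentAt_le β e v) (hcomp e)
      obtain ⟨S, hS⟩ := sum_homogeneousVector β v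
      refine ⟨∑ e ∈ S, homogeneousVector γ e (y e), ?_⟩
      rw [map_sum]
      conv_rhs => rw [hS]
      refine Finset.sum_congr rfl fun e _ => ?_
      rw [Matrix.mulVecLin_apply, homogeneousMatrix_mulVec_homogeneousVector hB e (hy e), hBy]
    · rintro ⟨w, rfl⟩
      obtain ⟨S, hS⟩ := sum_homogeneousVector γ w
      rw [hS, map_sum, map_sum]
      refine Finset.sum_eq_zero fun e _ => ?_
      have hz := homogeneousComponentAt_le γ e w
      have hBz : ∀ b, (B.mulVec (homogeneousComponentAt γ e w)) b ≠ 0 → β b ≤ e := by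
        intro b hb
        obtain ⟨c, _, hc⟩ := Finset.exists_ne_zero_of_sum_ne_zero hb
        exact (hB b c (left_ne_zero_of_mul hc)).trans (hz c (right_ne_zero_of_mul hc))
      rw [Matrix.mulVecLin_apply, Matrix.mulVecLin_apply,
        homogeneousMatrix_mulVec_homogeneousVector hB e hz,
        homogeneousMatrix_mulVec_homogeneousVector hA e hBz, Matrix.mulVec_mulVec, hAB,
        Matrix.zero_mulVec]
      ext1 a
      simp [homogeneousVector]

end HomogeneousMatrix

/-! ### Based complexes as poset-graded complexes -/

namespace BasedComplex

variable {k : Type*} [Field k] {P : Type*} [Preorder P]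

/-- The coordinate vectors of homological degree `i` inside the total space of a based complex. -/
noncomputable def incl (U : BasedComplex k) (i : ℕ) :
    (Fin (U.rank i) → k) →ₗ[k] ((Σ i, Fin (U.rank i)) →₀ k) :=
  Fintype.linearCombination k fun a => Finsupp.single ⟨i, a⟩ 1

/-- The total differential of a based complex. -/
noncomputable def totalDifferential (U : BasedComplex k) :
    ((Σ i, Fin (U.rank i)) →₀ k) →ₗ[k] ((Σ i, Fin (U.rank i)) →₀ k) :=
  Finsupp.linearCombination k fun x => match x with
    | ⟨0, _⟩ => 0
    | ⟨i + 1, b⟩ => U.incl i fun a => U.d i a b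

theorem incl_apply (U : BasedComplex k) (i : ℕ) (x : Fin (U.rank i) → k) :
    U.incl i x = ∑ a, Finsupp.single ⟨i, a⟩ (x a) := by
  simp [incl, Fintype.linearCombination_apply]

theorem incl_apply_same (U : BasedComplex k) (i : ℕ) (x : Fin (U.rank i) → k)
    (a : Fin (U.rank i)) : U.incl i x ⟨i, a⟩ = x a := by
  classical
  rw [incl_apply, Finsupp.finsetSum_apply, Finset.sum_eq_single a]
  · simp
  · intro b _ hb
    rw [Finsupp.single_apply, if_neg]
    intro h
    exact hb (by simpa using h)
  · simp

theorem incl_apply_ne (U : BasedComplex k) {i j : ℕ} (hij : i ≠ j) (x : Fin (U.rank i) → k)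
    (a : Fin (U.rank j)) : U.incl i x ⟨j, a⟩ = 0 := by
  classical
  rw [incl_apply, Finsupp.finsetSum_apply]
  refine Finset.sum_eq_zero fun b _ => ?_
  rw [Finsupp.single_apply, if_neg]
  intro h
  exact hij (congrArg Sigma.fst h)

theorem incl_single (U : BasedComplex k) (i : ℕ) (a : Fin (U.rank i)) (c : k) :
    U.incl i (Pi.single a c) = Finsupp.single ⟨i, a⟩ c := by
  classical
  rw [incl, Fintype.linearCombination_apply_single]
  simp

theorem totalDifferential_incl_zero (U : BasedComplex k) (x : Fin (U.rank 0) → k) :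
    U.totalDifferential (U.incl 0 x) = 0 := by
  rw [incl_apply, map_sum]
  exact Finset.sum_eq_zero fun a _ => by simp [totalDifferential]

theorem totalDifferential_incl_succ (U : BasedComplex k) (i : ℕ)
    (x : Fin (U.rank (i + 1)) → k) :
    U.totalDifferential (U.incl (i + 1) x) = U.incl i ((U.d i).mulVec x) := by
  rw [incl_apply, map_sum, Matrix.mulVec_eq_sum, map_sum]
  refine Finset.sum_congr rfl fun b _ => ?_
  rw [op_smul_eq_smul, map_smul]
  simp [totalDifferential]
  rfl

/-- A based complex with degrees of the basis elements that do not increase along the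
differential. -/
noncomputable def toPosetGraded (U : BasedComplex k) (deg : ∀ i, Fin (U.rank i) → P)
    (hdeg : ∀ i a b, U.d i a b ≠ 0 → deg i a ≤ deg (i + 1) b) : PosetGradedComplex k P where
  I := Σ i, Fin (U.rank i)
  gr x := x.1
  deg x := deg x.1 x.2
  d := U.totalDifferential
  d_single_mem := by
    rintro ⟨i, b⟩
    classical
    rw [← incl_single]
    cases i with
    | zero => rw [totalDifferential_incl_zero]; exact zero_mem _
    | succ i =>
      rw [totalDifferential_incl_succ, incl_apply]
      refine Submodule.sum_mem _ fun a _ => ?_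
      rw [Matrix.mulVec_single_one, Matrix.col_apply]
      by_cases h : U.d i a b = 0
      · rw [h, Finsupp.single_zero]; exact zero_mem _
      · exact Finsupp.single_mem_supported k _ ⟨rfl, hdeg i a b h⟩
  d_d z := by
    suffices U.totalDifferential ∘ₗ U.totalDifferential = 0 from LinearMap.congr_fun this z
    refine Finsupp.lhom_ext' fun x => LinearMap.ext_ring ?_
    obtain ⟨i, b⟩ := x
    simp only [LinearMap.comp_apply, Finsupp.lsingle_apply, LinearMap.zero_apply]
    rw [← incl_single]
    match i with
    | 0 => rw [totalDifferential_incl_zero, map_zero]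
    | 1 => rw [totalDifferential_incl_succ, totalDifferential_incl_zero]
    | i + 2 =>
      rw [totalDifferential_incl_succ, totalDifferential_incl_succ, Matrix.mulVec_mulVec,
        U.d_comp_d, Matrix.zero_mulVec, map_zero]

variable {U : BasedComplex k} {deg : ∀ i, Fin (U.rank i) → P}
  {hdeg : ∀ i a b, U.d i a b ≠ 0 → deg i a ≤ deg (i + 1) b}

theorem incl_injective (i : ℕ) : Function.Injective (U.incl i) := by
  intro x y h
  ext a
  rw [← U.incl_apply_same i x, h, U.incl_apply_same]

theorem incl_mem_chains_iff {J : Set P} {i : ℕ} {x : Fin (U.rank i) → k} :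
    U.incl i x ∈ (U.toPosetGraded deg hdeg).chains J i ↔ ∀ a, x a ≠ 0 → deg i a ∈ J := by
  constructor
  · intro h a ha
    exact (h (show (⟨i, a⟩ : Σ i, Fin (U.rank i)) ∈ ((U.incl i x).support : Set _) by
      simpa [incl_apply_same] using ha)).2
  · intro h
    rw [incl_apply]
    refine Submodule.sum_mem _ fun a _ => ?_
    by_cases ha : x a = 0
    · rw [ha, Finsupp.single_zero]; exact Submodule.zero_mem _
    · exact Finsupp.single_mem_supported k _ ⟨rfl, h a ha⟩

theorem exists_incl_eq {J : Set P} {i : ℕ} {z : (Σ i, Fin (U.rank i)) →₀ k}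
    (hz : z ∈ (U.toPosetGraded deg hdeg).chains J i) : ∃ x, U.incl i x = z := by
  refine ⟨fun a => z ⟨i, a⟩, ?_⟩
  ext ⟨j, a⟩
  by_cases hij : i = j
  · subst hij
    rw [incl_apply_same]
  · rw [incl_apply_ne U hij]
    by_contra h
    exact hij (hz (show (⟨j, a⟩ : Σ i, Fin (U.rank i)) ∈ (z.support : Set _) by
      simpa using Ne.symm h)).1.symm

theorem toPosetGraded_exactOn_iff {J : Set P} : (U.toPosetGraded deg hdeg).ExactOn J ↔
    ∀ i, ∀ x : Fin (U.rank (i + 1)) → k, (∀ a, x a ≠ 0 → deg (i + 1) a ∈ J) →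
      (U.d i).mulVec x = 0 → ∃ y : Fin (U.rank (i + 2)) → k,
        (∀ b, y b ≠ 0 → deg (i + 2) b ∈ J) ∧ (U.d (i + 1)).mulVec y = x := by
  constructor
  · intro h i x hx hdx
    obtain ⟨w, hw, hdw⟩ := h i (U.incl (i + 1) x) (incl_mem_chains_iff.2 hx)
      ((U.totalDifferential_incl_succ i x).trans (by rw [hdx, map_zero]; rfl))
    obtain ⟨y, rfl⟩ := exists_incl_eq hw
    exact ⟨y, incl_mem_chains_iff.1 hw,
      incl_injective _ ((U.totalDifferential_incl_succ (i + 1) y).symm.trans hdw)⟩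
  · intro h i z hz hdz
    obtain ⟨x, rfl⟩ := exists_incl_eq hz
    have hdx : U.incl i ((U.d i).mulVec x) = 0 := (U.totalDifferential_incl_succ i x).symm.trans hdz
    obtain ⟨y, hy, hdy⟩ := h i x (incl_mem_chains_iff.1 hz)
      (incl_injective i (hdx.trans (map_zero _).symm))
    exact ⟨U.incl (i + 2) y, incl_mem_chains_iff.2 hy,
      (U.totalDifferential_incl_succ (i + 1) y).trans (by rw [hdy])⟩

end BasedComplex

namespace BasedComplex

variable {k : Type*} [Field k] {P : Type*} [PartialOrder P] {U : BasedComplex k}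
  {deg : ∀ i, Fin (U.rank i) → P} {hdeg : ∀ i a b, U.d i a b ≠ 0 → deg i a ≤ deg (i + 1) b}

/-- The form in which minimality is used: a contribution to the entry at `v` must come from a degree
strictly above that of `v`. -/
theorem mulVec_apply_eq_zero_of_strict (hstrict : ∀ i a b, U.d i a b ≠ 0 → deg i a ≠ deg (i + 1) b)
    (hdeg : ∀ i a b, U.d i a b ≠ 0 → deg i a ≤ deg (i + 1) b)
    {i : ℕ} {v : Fin (U.rank i)} {y : Fin (U.rank (i + 1)) → k}
    (hy : ∀ b, y b ≠ 0 → deg (i + 1) b ≤ deg i v) : (U.d i).mulVec y v = 0 := by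
  rw [Matrix.mulVec, dotProduct]
  refine Finset.sum_eq_zero fun b _ => ?_
  by_contra h
  have h1 := left_ne_zero_of_mul h
  exact hstrict i v b h1 (le_antisymm (hdeg i v b h1) (hy b (right_ne_zero_of_mul h)))

/-- In a complex with strictly increasing degrees, the boundary of a basis element cannot be a
boundary of elements of other degrees below its own degree. -/
theorem false_of_exactOn (hstrict : ∀ i a b, U.d i a b ≠ 0 → deg i a ≠ deg (i + 1) b) {i : ℕ}
    {v : Fin (U.rank (i + 2))} {J : Set P} (hJ : J ⊆ Set.Iic (deg (i + 2) v))
    (hv : deg (i + 2) v ∉ J) (hexJ : (U.toPosetGraded deg hdeg).ExactOn J)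
    (hexv : (U.toPosetGraded deg hdeg).ExactOn (Set.Iic (deg (i + 2) v)))
    (hd : ∀ a, U.d (i + 1) a v ≠ 0 → deg (i + 1) a ∈ J) : False := by
  classical
  rw [toPosetGraded_exactOn_iff] at hexJ hexv
  obtain ⟨y, hy, hdy⟩ := hexJ i ((U.d (i + 1)).mulVec (Pi.single v 1))
    (fun a ha => hd a (by simpa using ha))
    (by rw [Matrix.mulVec_mulVec, U.d_comp_d, Matrix.zero_mulVec])
  have hyv : y v = 0 := by
    by_contra h
    exact hv (hy v h)
  -- `v - y` is a cycle in degrees at most `deg v`, hence a boundary there; but its coefficient at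
  -- `v` is `1`, against minimality.
  obtain ⟨z, hz, hdz⟩ := hexv (i + 1) (Pi.single v 1 - y) (fun a ha => by
      by_cases hav : a = v
      · subst hav; exact le_rfl
      · refine hJ (hy a fun h => ha ?_)
        simp [hav, h])
    (by rw [Matrix.mulVec_sub, hdy, sub_self])
  have h0 := mulVec_apply_eq_zero_of_strict hstrict hdeg (v := v) (y := z) hz
  rw [hdz] at h0
  simp [hyv] at h0

end BasedComplex

/-! ### Low homological degrees and comparison with Taylor -/

/-- The complex `U` with the degrees `deg` looks in homological degrees `0` and `1` like a minimal
resolution of the quotient by the monomial ideal with generators `m`. -/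
structure BasedComplex.IsPresentation {k : Type*} [Field k] {σ : Type*} {r : ℕ}
    (U : BasedComplex k) (deg : ∀ i, Fin (U.rank i) → (σ →₀ ℕ)) (m : Fin r → (σ →₀ ℕ))
    (o : Fin (U.rank 0)) : Prop where
  eq_origin : ∀ a, a = o
  deg_origin : deg 0 o = 0
  deg_one : ∀ j, ∃ i, deg 1 j = m i
  exists_deg_one : ∀ i, ∃ j, deg 1 j = m i
  d_ne_zero : ∀ j, U.d 0 o j ≠ 0

namespace BasedComplex.IsPresentation

variable {k : Type*} [Field k] {σ : Type*} {r : ℕ} {U : BasedComplex k}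
  {deg : ∀ i, Fin (U.rank i) → (σ →₀ ℕ)} {m : Fin r → (σ →₀ ℕ)} {o : Fin (U.rank 0)}
  {hdeg : ∀ i a b, U.d i a b ≠ 0 → deg i a ≤ deg (i + 1) b}

theorem isOrigin_taylor (h : U.IsPresentation deg m o) (J : Set (σ →₀ ℕ)) :
    PosetGradedComplex.IsOrigin (U.toPosetGraded deg hdeg) (taylorComplex k m)
      (∅ : Finset (Fin r)) J where
  gr_eq_zero := Finset.card_empty (α := Fin r)
  eq_of_gr _ hy := Finset.card_eq_zero.1 hy
  deg_le e := show (∅ : Finset (Fin r)).sup m ≤ e by rw [Finset.sup_empty]; exact bot_le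
  bounds := by
    rintro ⟨i, j⟩ hx _
    obtain rfl : i = 1 := hx
    obtain ⟨i, hi⟩ := h.deg_one j
    refine ⟨Finsupp.single ({i} : Finset (Fin r)) 1,
      Finsupp.single_mem_supported k _ ⟨Finset.card_singleton i, ?_⟩, ?_⟩
    · change ({i} : Finset (Fin r)).sup m ≤ deg 1 j
      rw [Finset.sup_singleton, hi]
    · refine (simplicialBoundary_single k {i}).trans ?_
      simp [Finset.filter_singleton]
      rfl

theorem isOrigin (h : U.IsPresentation deg m o) (J : Set (σ →₀ ℕ)) :
    PosetGradedComplex.IsOrigin (taylorComplex k m) (U.toPosetGraded deg hdeg) ⟨0, o⟩ J where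
  gr_eq_zero := rfl
  eq_of_gr := by
    rintro ⟨i, a⟩ hx
    obtain rfl : i = 0 := hx
    rw [h.eq_origin a]
  deg_le e := show deg 0 o ≤ e by rw [h.deg_origin]; exact bot_le
  bounds := by
    classical
    intro A hA _
    obtain ⟨i, rfl⟩ := Finset.card_eq_one.1 hA
    obtain ⟨j, hj⟩ := h.exists_deg_one i
    refine ⟨U.incl 1 (Pi.single j (U.d 0 o j)⁻¹), incl_mem_chains_iff.2 fun a ha => ?_, ?_⟩
    · obtain rfl : a = j := by
        by_contra hne
        simp [hne] at ha
      change deg 1 a ≤ ({i} : Finset (Fin r)).sup m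
      rw [Finset.sup_singleton, hj]
    · refine (U.totalDifferential_incl_succ 0 _).trans ?_
      refine Eq.trans ?_ (U.incl_single 0 o 1)
      congr 1
      ext a
      rw [h.eq_origin a]
      simp [h.d_ne_zero j]

/-- The comparison with the Taylor complex. -/
theorem exactOn_Iio (h : U.IsPresentation deg m o) {e : σ →₀ ℕ} (he : e ∉ bettiPoset k m)
    (hex : ∀ e' < e, (U.toPosetGraded deg hdeg).ExactOn (Set.Iic e')) :
    (U.toPosetGraded deg hdeg).ExactOn (Set.Iio e) :=
  PosetGradedComplex.exactOn_of_exactOn (isLowerSet_Iio e) (h.isOrigin _) (h.isOrigin_taylor _)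
    hex (fun e' _ => taylorComplex_exactOn_Iic k m e') (taylorComplex_exactOn_Iio he)

end BasedComplex.IsPresentation

/-! ### Minimal resolutions in terms of their frames -/

theorem IsMinimalMonomialGenerators.monomial_mem_iff {k σ : Type*} [Field k] {r : ℕ}
    {M : Ideal (MvPolynomial σ k)} {m : Fin r → (σ →₀ ℕ)} (hm : IsMinimalMonomialGenerators M m)
    {e : σ →₀ ℕ} {c : k} (hc : c ≠ 0) :
    MvPolynomial.monomial e c ∈ M ↔ ∃ i, m i ≤ e := by
  classical
  have hr : (Set.range fun i => MvPolynomial.monomial (m i) (1 : k)) =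
      (fun u => MvPolynomial.monomial u (1 : k)) '' Set.range m := by
    rw [← Set.range_comp]; rfl
  rw [hm.span_eq, hr, MvPolynomial.mem_ideal_span_monomial_image, MvPolynomial.support_monomial,
    if_neg hc]
  simp

theorem IsMinimalMonomialGenerators.generator_ne_zero {k σ : Type*} [Field k] {r : ℕ}
    {M : Ideal (MvPolynomial σ k)} {m : Fin r → (σ →₀ ℕ)} (hm : IsMinimalMonomialGenerators M m)
    (hM : M ≠ ⊤) (i : Fin r) : m i ≠ 0 := by
  intro h
  refine hM ((Ideal.eq_top_iff_one M).2 ?_)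
  exact (hm.monomial_mem_iff (e := 0) one_ne_zero).2 ⟨i, h.le⟩

theorem IsMinimalMonomialGenerators.constantCoeff_eq_zero {k σ : Type*} [Field k] {r : ℕ}
    {M : Ideal (MvPolynomial σ k)} {m : Fin r → (σ →₀ ℕ)} (hm : IsMinimalMonomialGenerators M m)
    (hM : M ≠ ⊤) {p : MvPolynomial σ k} (hp : p ∈ M) : MvPolynomial.constantCoeff p = 0 := by
  suffices M ≤ RingHom.ker (MvPolynomial.constantCoeff (σ := σ) (R := k)) from this hp
  conv_lhs => rw [hm.span_eq]
  rw [Ideal.span_le]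
  rintro _ ⟨i, rfl⟩
  classical
  simp [MvPolynomial.constantCoeff_monomial, hm.generator_ne_zero hM i]

/-- The homogeneous matrices of the based complex `U` with the degrees `deg` form a minimal free
resolution of the quotient by `M`. -/
structure BasedComplex.IsMinimalResolution {k : Type*} [Field k] {σ : Type*} (U : BasedComplex k)
    (deg : ∀ i, Fin (U.rank i) → (σ →₀ ℕ)) (M : Ideal (MvPolynomial σ k)) : Prop where
  deg_le : ∀ i a b, U.d i a b ≠ 0 → deg i a ≤ deg (i + 1) b
  deg_ne : ∀ i a b, U.d i a b ≠ 0 → deg i a ≠ deg (i + 1) b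
  exact : ∀ i, Function.Exact
    (homogeneousMatrix (deg (i + 1)) (deg (i + 2)) (U.d (i + 1))).mulVecLin
    (homogeneousMatrix (deg i) (deg (i + 1)) (U.d i)).mulVecLin
  augmentation : ∃ ε : (Fin (U.rank 0) → MvPolynomial σ k) →ₗ[MvPolynomial σ k]
      (MvPolynomial σ k ⧸ M),
    Function.Surjective ε ∧
    Function.Exact (homogeneousMatrix (deg 0) (deg 1) (U.d 0)).mulVecLin ε ∧
    ∀ a, ∃ c : k, ε (Pi.single a 1) =
      Ideal.Quotient.mk M (MvPolynomial.monomial (deg 0 a) c)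

namespace MultigradedComplex

variable {k : Type*} [Field k] {σ : Type*} {F : MultigradedComplex k σ}
  {M : Ideal (MvPolynomial σ k)}

/-- Homogeneity allows a single exponent in each entry, so the frame and the degrees determine the
differential. -/
theorem d_eq_monomial (F : MultigradedComplex k σ) (i : ℕ) (a : Fin (F.rank i))
    (b : Fin (F.rank (i + 1))) : F.d i a b =
      MvPolynomial.monomial (F.mdeg (i + 1) b - F.mdeg i a) (F.frame.d i a b) := by
  classical
  have h : F.d i a b = MvPolynomial.monomial (F.mdeg (i + 1) b - F.mdeg i a)
      ((F.d i a b).coeff (F.mdeg (i + 1) b - F.mdeg i a)) := by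
    ext u
    rw [MvPolynomial.coeff_monomial]
    split_ifs with hu
    · rw [hu]
    · by_contra hne
      have := F.multigraded i a b u (by simpa using hne)
      exact hu (by rw [← this, add_tsub_cancel_left])
  have h2 : F.frame.d i a b = (F.d i a b).coeff (F.mdeg (i + 1) b - F.mdeg i a) := by
    change MvPolynomial.eval (fun _ => (1 : k)) (F.d i a b) = _
    conv_lhs => rw [h, MvPolynomial.eval_monomial]
    simp
  rw [h2, ← h]

theorem mdeg_le (F : MultigradedComplex k σ) (i : ℕ) (a : Fin (F.frame.rank i))
    (b : Fin (F.frame.rank (i + 1))) (h : F.frame.d i a b ≠ 0) :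
    F.mdeg i a ≤ F.mdeg (i + 1) b := by
  have hne : F.d i a b ≠ 0 := by
    intro h0
    apply h
    change MvPolynomial.eval (fun _ => (1 : k)) (F.d i a b) = 0
    rw [h0, map_zero]
  obtain ⟨u, hu⟩ := MvPolynomial.support_nonempty.2 hne
  rw [← F.multigraded i a b u hu]
  exact le_self_add

theorem IsMinimalFreeResolution.frame (hF : F.IsMinimalFreeResolution M) :
    F.frame.IsMinimalResolution F.mdeg M := by
  have hd : ∀ i, F.d i = homogeneousMatrix (F.mdeg i) (F.mdeg (i + 1))
      (show Matrix (Fin (F.rank i)) (Fin (F.rank (i + 1))) k from F.frame.d i) := fun i =>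
    Matrix.ext fun a b => F.d_eq_monomial i a b
  refine ⟨F.mdeg_le, fun i a b h he => ?_, fun i => ?_, ?_⟩
  · have h1 := hF.minimal i a b
    have h2 := F.d_eq_monomial i a b
    rw [he, tsub_self] at h2
    rw [h2] at h1
    exact h (by simpa using h1)
  · have h := hF.exact i
    rw [hd, hd] at h
    exact h
  · have h := hF.augmentation
    rw [hd] at h
    exact h

end MultigradedComplex

namespace BasedComplex.IsMinimalResolution

variable {k : Type*} [Field k] {σ : Type*} {r : ℕ} {U : BasedComplex k}
  {deg : ∀ i, Fin (U.rank i) → (σ →₀ ℕ)} {M : Ideal (MvPolynomial σ k)} {m : Fin r → (σ →₀ ℕ)}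

theorem exactOn_Iic (hF : U.IsMinimalResolution deg M) (e : σ →₀ ℕ) :
    (U.toPosetGraded deg hF.deg_le).ExactOn (Set.Iic e) := by
  rw [BasedComplex.toPosetGraded_exactOn_iff]
  intro i
  have h := hF.exact i
  exact (exact_homogeneousMatrix_iff (hF.deg_le i) (hF.deg_le (i + 1)) (U.d_comp_d i)).1 h e

/-- Rank one in degree `0` must be derived. Since `1` is in the image of `ε` and `M` has no constant
terms, some basis element `o` has degree `1` (exponent `0`) and maps to a nonzero scalar. Any other
`b` would give a kernel element, `b` minus a monomial multiple of `o`, with an entry `1`,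
contradicting minimality. -/
theorem exists_origin (hF : U.IsMinimalResolution deg M) (hM : M ≠ ⊤)
    (hm : IsMinimalMonomialGenerators M m) :
    ∃ o : Fin (U.rank 0), (∀ a, a = o) ∧ deg 0 o = 0 ∧
      ∀ v : Fin (U.rank 0) → MvPolynomial σ k, v o ∈ M ↔
        ∃ w, (homogeneousMatrix (deg 0) (deg 1) (U.d 0)).mulVec w = v := by
  classical
  have hmin : ∀ a b, MvPolynomial.constantCoeff
      (homogeneousMatrix (deg 0) (deg 1) (U.d 0) a b) = 0 := by
    intro a b
    rw [homogeneousMatrix, Matrix.of_apply, MvPolynomial.constantCoeff_monomial]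
    split_ifs with h
    · by_contra hne
      exact hF.deg_ne 0 a b hne (le_antisymm (hF.deg_le 0 a b hne) (tsub_eq_zero_iff_le.1 h))
    · rfl
  obtain ⟨ε, hsurj, hex, hgr⟩ := hF.augmentation
  choose c hc using hgr
  have hε : ∀ v, ε v = Ideal.Quotient.mk M
      (∑ a, v a * MvPolynomial.monomial (deg 0 a) (c a)) := by
    intro v
    conv_lhs => rw [pi_eq_sum_univ' v]
    rw [map_sum, map_sum]
    refine Finset.sum_congr rfl fun a _ => ?_
    rw [map_smul, hc, ← Ideal.Quotient.mk_eq_mk, ← Ideal.Quotient.mk_eq_mk,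
      ← Submodule.Quotient.mk_smul, smul_eq_mul]
  obtain ⟨v, hv⟩ := hsurj 1
  rw [hε, ← map_one (Ideal.Quotient.mk M), Ideal.Quotient.eq] at hv
  have h1 := hm.constantCoeff_eq_zero hM hv
  rw [map_sub, map_one, sub_eq_zero, map_sum] at h1
  obtain ⟨o, _, ho⟩ := Finset.exists_ne_zero_of_sum_ne_zero (h1.trans_ne one_ne_zero)
  rw [map_mul] at ho
  have ho' := right_ne_zero_of_mul ho
  rw [MvPolynomial.constantCoeff_monomial] at ho'
  split_ifs at ho' with hdeg
  · have hall : ∀ a, a = o := by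
      intro b
      by_contra hb
      let w : Fin (U.rank 0) → MvPolynomial σ k := Pi.single b 1 -
        Pi.single o (MvPolynomial.monomial (deg 0 b) (c b * (c o)⁻¹))
      have hw : ε w = 0 := by
        have hsum : ∀ (x : Fin (U.rank 0)) (p : MvPolynomial σ k),
            ε (Pi.single x p) = Ideal.Quotient.mk M
              (p * MvPolynomial.monomial (deg 0 x) (c x)) := by
          intro x p
          rw [hε, Finset.sum_eq_single x]
          · simp
          · intro y _ hy; simp [hy]
          · simp
        rw [map_sub, hsum, hsum, hdeg, one_mul, MvPolynomial.monomial_mul, add_zero, mul_assoc,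
          inv_mul_cancel₀ ho', mul_one, sub_self]
      obtain ⟨y, hy⟩ := (hex w).1 hw
      have hwb : w b = 1 := by simp [w, hb]
      have h0 : MvPolynomial.constantCoeff (w b) = 0 := by
        rw [← hy, Matrix.mulVecLin_apply]
        simp only [Matrix.mulVec, dotProduct, map_sum, map_mul, hmin, zero_mul,
          Finset.sum_const_zero]
      rw [hwb, map_one] at h0
      exact one_ne_zero h0
    refine ⟨o, hall, hdeg, fun v => ?_⟩
    have hk : ε v = 0 ↔ v o ∈ M := by
      rw [hε, Ideal.Quotient.eq_zero_iff_mem, Finset.sum_eq_single o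
        (fun b _ hb => absurd (hall b) hb) (fun h => absurd (Finset.mem_univ o) h), hdeg]
      refine ⟨fun h => ?_, fun h => M.mul_mem_right _ h⟩
      have := M.mul_mem_right (MvPolynomial.monomial 0 (c o)⁻¹) h
      rwa [mul_assoc, MvPolynomial.monomial_mul, mul_inv_cancel₀ ho', add_zero,
        MvPolynomial.monomial_zero', map_one, mul_one] at this
    rw [← hk]
    exact hex v
  · exact absurd rfl ho'

/-- By minimality a cycle in degrees at most `deg 1 j` has no `j`-entry (`hmin`). Applied to `j`
alone this makes `d j` nonzero; applied to the syzygy of two basis elements it makes their degrees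
an antichain. These degrees generate `M`, so they are its minimal generators. -/
theorem exists_isPresentation (hF : U.IsMinimalResolution deg M) (hM : M ≠ ⊤)
    (hm : IsMinimalMonomialGenerators M m) :
    ∃ o, U.IsPresentation deg m o ∧ Function.Injective (deg 1) := by
  classical
  obtain ⟨o, hall, hdeg, hker⟩ := hF.exists_origin hM hm
  have hmin : ∀ (j : Fin (U.rank 1)) (x : Fin (U.rank 1) → k),
      (∀ b, x b ≠ 0 → deg 1 b ≤ deg 1 j) → (U.d 0).mulVec x o = 0 → x j = 0 := by
    intro j x hx hdx
    have hdx' : (U.d 0).mulVec x = 0 := by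
      ext a
      rw [hall a, hdx]; rfl
    obtain ⟨y, hy, rfl⟩ := BasedComplex.toPosetGraded_exactOn_iff.1 (hF.exactOn_Iic (deg 1 j))
      0 x hx hdx'
    exact BasedComplex.mulVec_apply_eq_zero_of_strict hF.deg_ne hF.deg_le hy
  have hne : ∀ j, U.d 0 o j ≠ 0 := by
    intro j h
    have := hmin j (Pi.single j 1) (fun b hb => by
      obtain rfl : b = j := by
        by_contra hbj
        simp [hbj] at hb
      exact le_rfl) (by simpa using h)
    simp at this
  have hinj : ∀ j j', deg 1 j' ≤ deg 1 j → j' = j := by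
    intro j j' hle
    by_contra hjj
    have := hmin j (Pi.single j (U.d 0 o j') - Pi.single j' (U.d 0 o j))
      (fun b hb => by
        by_cases h1 : b = j
        · rw [h1]
        by_cases h2 : b = j'
        · rw [h2]; exact hle
        · simp [h1, h2] at hb)
      (by simp [Matrix.mulVec_sub, mul_comm])
    simp [Ne.symm hjj] at this
    exact hne j' this
  have hdvd : ∀ j, ∃ i, m i ≤ deg 1 j := by
    intro j
    have h1 := (hker ((homogeneousMatrix (deg 0) (deg 1) (U.d 0)).mulVec
      (Pi.single j 1))).2 ⟨_, rfl⟩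
    rw [Matrix.mulVec_single_one, Matrix.col_apply, homogeneousMatrix, Matrix.of_apply, hdeg,
      tsub_zero] at h1
    exact (hm.monomial_mem_iff (hne j)).1 h1
  have hgen : ∀ i, ∃ j, deg 1 j ≤ m i := by
    intro i
    obtain ⟨w, hw⟩ := (hker fun _ => MvPolynomial.monomial (m i) 1).1
      ((hm.monomial_mem_iff one_ne_zero).2 ⟨i, le_rfl⟩)
    have h1 : homogeneousComponentAt (deg 0) (m i)
        ((homogeneousMatrix (deg 0) (deg 1) (U.d 0)).mulVec w) o = 1 := by
      rw [hw]
      simp [homogeneousComponentAt, hdeg]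
    rw [homogeneousComponentAt_mulVec (hF.deg_le 0)] at h1
    rw [Matrix.mulVec, dotProduct] at h1
    obtain ⟨j, _, hj⟩ := Finset.exists_ne_zero_of_sum_ne_zero (h1.trans_ne one_ne_zero)
    exact ⟨j, homogeneousComponentAt_le _ _ w j (right_ne_zero_of_mul hj)⟩
  have hone : ∀ j, ∃ i, deg 1 j = m i := by
    intro j
    obtain ⟨i, hi⟩ := hdvd j
    obtain ⟨j', hj'⟩ := hgen i
    obtain rfl := hinj j j' (hj'.trans hi)
    exact ⟨i, le_antisymm hj' hi⟩
  refine ⟨o, ⟨hall, hdeg, hone, fun i => ?_, hne⟩, fun j j' h => hinj j' j h.le⟩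
  obtain ⟨j, hj⟩ := hgen i
  obtain ⟨i', hi'⟩ := hone j
  refine ⟨j, ?_⟩
  have : i' = i := by
    by_contra hii
    exact hm.not_dvd i' i hii (hi' ▸ hj)
  rw [hi', this]

/-- The multidegrees of the basis elements of a minimal free resolution lie in the Betti poset. -/
theorem deg_mem_bettiPoset (hF : U.IsMinimalResolution deg M) (hM : M ≠ ⊤)
    (hm : IsMinimalMonomialGenerators M m) (i : ℕ) (v : Fin (U.rank i)) :
    deg i v ∈ bettiPoset k m := by
  obtain ⟨o, ho, -⟩ := hF.exists_isPresentation hM hm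
  match i with
  | 0 =>
    rw [ho.eq_origin v, ho.deg_origin]
    exact zero_mem_bettiPoset
  | 1 =>
    obtain ⟨j, hj⟩ := ho.deg_one v
    rw [hj]
    exact generator_mem_bettiPoset hm.not_dvd j
  | i + 2 =>
    by_contra hv
    exact BasedComplex.false_of_exactOn hF.deg_ne (J := Set.Iio (deg (i + 2) v))
      (fun e he => le_of_lt he) Set.self_notMem_Iio
      (ho.exactOn_Iio hv fun e _ => hF.exactOn_Iic e) (hF.exactOn_Iic _)
      (fun a ha => lt_of_le_of_ne (hF.deg_le _ _ _ ha) (hF.deg_ne _ _ _ ha))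

end BasedComplex.IsMinimalResolution

/-! ### Isomorphisms of Betti posets -/

section BettiPosetIso

variable {k : Type*} [Field k] {σ τ : Type*} {r s : ℕ} {m : Fin r → (σ →₀ ℕ)}
  {m' : Fin s → (τ →₀ ℕ)}

theorem exists_generator_le {a : σ →₀ ℕ} (ha : a ∈ bettiPoset k m) (h0 : a ≠ 0) :
    ∃ i, m i ≤ a := by
  obtain ⟨⟨A, rfl⟩, -⟩ := ha
  obtain ⟨i, hi⟩ : A.Nonempty := by
    rw [Finset.nonempty_iff_ne_empty]
    rintro rfl
    exact h0 Finset.sup_empty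
  exact ⟨i, Finset.le_sup hi⟩

theorem bettiPoset_iso_zero (f : bettiPoset k m ≃o bettiPoset k m') :
    f ⟨0, zero_mem_bettiPoset⟩ = ⟨0, zero_mem_bettiPoset⟩ := by
  refine le_antisymm ?_ (show (0 : τ →₀ ℕ) ≤ _ from bot_le)
  rw [← f.le_symm_apply]
  exact show (0 : σ →₀ ℕ) ≤ _ from bot_le

theorem bettiPoset_iso_ne_zero (f : bettiPoset k m ≃o bettiPoset k m') {a : bettiPoset k m}
    (ha : (a : σ →₀ ℕ) ≠ 0) : (f a : τ →₀ ℕ) ≠ 0 := by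
  intro h
  have h1 : f a = f ⟨0, zero_mem_bettiPoset⟩ := by
    rw [bettiPoset_iso_zero]
    exact Subtype.ext h
  exact ha (congrArg Subtype.val (f.injective h1))

/-- Generators are the minimal nonzero elements: pull back some `m' j` below `f (m i)`, find a
generator below the result, and use the antichain property. -/
theorem bettiPoset_iso_generator (f : bettiPoset k m ≃o bettiPoset k m')
    (h0 : ∀ i, m i ≠ 0) (h0' : ∀ i, m' i ≠ 0) (hm : ∀ i j, i ≠ j → ¬ m i ≤ m j)
    (hm' : ∀ i j, i ≠ j → ¬ m' i ≤ m' j) (i : Fin r) :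
    ∃ j, f ⟨m i, generator_mem_bettiPoset hm i⟩ = ⟨m' j, generator_mem_bettiPoset hm' j⟩ := by
  obtain ⟨j, hj⟩ := exists_generator_le (f ⟨m i, generator_mem_bettiPoset hm i⟩).2
    (bettiPoset_iso_ne_zero f (h0 i))
  have hj' : f.symm ⟨m' j, generator_mem_bettiPoset hm' j⟩ ≤
      ⟨m i, generator_mem_bettiPoset hm i⟩ := by
    rw [f.symm_apply_le]
    exact hj
  obtain ⟨i', hi'⟩ := exists_generator_le (f.symm ⟨m' j, generator_mem_bettiPoset hm' j⟩).2
    (bettiPoset_iso_ne_zero f.symm (h0' j))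
  have hii : i' = i := by
    by_contra hne
    exact hm i' i hne (hi'.trans hj')
  subst hii
  refine ⟨j, ?_⟩
  rw [← f.apply_symm_apply ⟨m' j, generator_mem_bettiPoset hm' j⟩]
  exact congrArg f (le_antisymm hi' hj')

end BettiPosetIso

/-! ### Transport of degrees and homogenization -/

namespace BasedComplex

variable {k : Type*} [Field k] {σ τ : Type*} {r s : ℕ} {U : BasedComplex k}
  {deg : ∀ i, Fin (U.rank i) → (σ →₀ ℕ)} {m : Fin r → (σ →₀ ℕ)} {m' : Fin s → (τ →₀ ℕ)}

/-- A complex all of whose strands are exact in positive degrees, and which starts like a resolution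
of the quotient by a monomial ideal, is a minimal resolution if its degrees increase strictly. -/
theorem IsPresentation.isMinimalResolution {N : Ideal (MvPolynomial σ k)}
    {o : Fin (U.rank 0)} (h : U.IsPresentation deg m o) (hm : IsMinimalMonomialGenerators N m)
    (hdeg : ∀ i a b, U.d i a b ≠ 0 → deg i a ≤ deg (i + 1) b)
    (hne : ∀ i a b, U.d i a b ≠ 0 → deg i a ≠ deg (i + 1) b)
    (hex : ∀ e, (U.toPosetGraded deg hdeg).ExactOn (Set.Iic e)) :
    U.IsMinimalResolution deg N := by
  classical
  refine ⟨hdeg, hne, fun i => ?_, ?_⟩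
  · exact (exact_homogeneousMatrix_iff (hdeg i) (hdeg (i + 1)) (U.d_comp_d i)).2
      fun e => toPosetGraded_exactOn_iff.1 (hex e) i
  · refine ⟨N.mkQ ∘ₗ LinearMap.proj o, ?_, fun v => ?_, fun a => ⟨1, ?_⟩⟩
    · intro x
      obtain ⟨p, rfl⟩ := N.mkQ_surjective x
      exact ⟨fun _ => p, rfl⟩
    · have happ : ∀ w, (homogeneousMatrix (deg 0) (deg 1) (U.d 0)).mulVec w o =
          ∑ j, MvPolynomial.monomial (deg 1 j) (U.d 0 o j) * w j := by
        intro w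
        simp only [Matrix.mulVec, dotProduct, homogeneousMatrix, Matrix.of_apply, h.deg_origin,
          tsub_zero]
      have hz : (N.mkQ ∘ₗ LinearMap.proj o) v = 0 ↔ v o ∈ N := by
        rw [LinearMap.comp_apply, LinearMap.proj_apply, Submodule.mkQ_apply,
          Submodule.Quotient.mk_eq_zero]
      rw [hz]
      constructor
      · intro hv
        -- It suffices to hit the generators; each is the image of a scaled basis element.
        have hle : N ≤ LinearMap.range (LinearMap.proj o ∘ₗ
            (homogeneousMatrix (deg 0) (deg 1) (U.d 0)).mulVecLin) := by
          conv_lhs => rw [hm.span_eq]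
          refine Submodule.span_le.2 ?_
          rintro _ ⟨i, rfl⟩
          obtain ⟨j, hj⟩ := h.exists_deg_one i
          refine ⟨Pi.single j (MvPolynomial.C (U.d 0 o j)⁻¹), ?_⟩
          rw [LinearMap.comp_apply, LinearMap.proj_apply, Matrix.mulVecLin_apply, happ,
            Finset.sum_eq_single j (fun b _ hb => by simp [hb]) (by simp), Pi.single_eq_same,
            mul_comm, MvPolynomial.C_mul_monomial, inv_mul_cancel₀ (h.d_ne_zero j), hj]
        obtain ⟨w, hw⟩ := hle hv
        refine ⟨w, ?_⟩
        ext1 a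
        rw [h.eq_origin a]
        exact hw
      · rintro ⟨w, rfl⟩
        rw [Matrix.mulVecLin_apply, happ]
        refine N.sum_mem fun j _ => N.mul_mem_right _ ?_
        obtain ⟨i, hi⟩ := h.deg_one j
        exact (hm.monomial_mem_iff (h.d_ne_zero j)).2 ⟨i, hi.ge⟩
    · rw [h.eq_origin a, h.deg_origin]
      simp

theorem IsMinimalResolution.homogenization {g : Fin (U.rank 1) → (σ →₀ ℕ)}
    {N : Ideal (MvPolynomial σ k)} (h : U.IsMinimalResolution (U.homogenizationDegree g) N) :
    (U.homogenization g).IsMinimalFreeResolution N where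
  exact := h.exact
  augmentation := h.augmentation
  minimal i a b := by
    classical
    refine (MvPolynomial.constantCoeff_monomial _ _).trans ?_
    split_ifs with he
    · by_contra hne
      exact h.deg_ne i a b hne (le_antisymm (h.deg_le i a b hne) (tsub_eq_zero_iff_le.1 he))
    · rfl

variable {M : Ideal (MvPolynomial σ k)}

/-- The degrees of a complex of a minimal resolution, transported along an isomorphism of Betti
posets. -/
def transportDegree (hmem : ∀ i v, deg i v ∈ bettiPoset k m)
    (f : bettiPoset k m ≃o bettiPoset k m') : ∀ i, Fin (U.rank i) → (τ →₀ ℕ) :=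
  fun i v => f ⟨deg i v, hmem i v⟩

variable {hmem : ∀ i v, deg i v ∈ bettiPoset k m} {f : bettiPoset k m ≃o bettiPoset k m'}

theorem transportDegree_le_iff {i j : ℕ} {v : Fin (U.rank i)} {w : Fin (U.rank j)} :
    transportDegree hmem f i v ≤ transportDegree hmem f j w ↔ deg i v ≤ deg j w :=
  f.le_iff_le (x := ⟨deg i v, hmem i v⟩) (y := ⟨deg j w, hmem j w⟩)

theorem transportDegree_mem (i : ℕ) (v : Fin (U.rank i)) :
    transportDegree hmem f i v ∈ bettiPoset k m' :=
  (f ⟨deg i v, hmem i v⟩).2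

theorem IsPresentation.transport {o : Fin (U.rank 0)} (h : U.IsPresentation deg m o)
    (h0 : ∀ i, m i ≠ 0) (h0' : ∀ i, m' i ≠ 0) (hm : ∀ i j, i ≠ j → ¬ m i ≤ m j)
    (hm' : ∀ i j, i ≠ j → ¬ m' i ≤ m' j) :
    U.IsPresentation (transportDegree hmem f) m' o where
  eq_origin := h.eq_origin
  deg_origin := by
    have : (⟨deg 0 o, hmem 0 o⟩ : bettiPoset k m) = ⟨0, zero_mem_bettiPoset⟩ :=
      Subtype.ext h.deg_origin
    rw [transportDegree, this, bettiPoset_iso_zero]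
  deg_one j := by
    obtain ⟨i, hi⟩ := h.deg_one j
    obtain ⟨i', hi'⟩ := bettiPoset_iso_generator f h0 h0' hm hm' i
    refine ⟨i', ?_⟩
    have : (⟨deg 1 j, hmem 1 j⟩ : bettiPoset k m) = ⟨m i, generator_mem_bettiPoset hm i⟩ :=
      Subtype.ext hi
    rw [transportDegree, this, hi']
  exists_deg_one i := by
    obtain ⟨i', hi'⟩ := bettiPoset_iso_generator f.symm h0' h0 hm' hm i
    obtain ⟨j, hj⟩ := h.exists_deg_one i'
    refine ⟨j, ?_⟩
    have : (⟨deg 1 j, hmem 1 j⟩ : bettiPoset k m) = ⟨m i', generator_mem_bettiPoset hm i'⟩ :=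
      Subtype.ext hj
    rw [transportDegree, this, ← hi', f.apply_symm_apply]
  d_ne_zero := h.d_ne_zero

/-- Induction on `e`, over all monomials and not only those of the Betti poset. Finiteness of `τ`
makes divisibility well-founded. -/
theorem exactOn_Iic_transport [Finite τ] {o : Fin (U.rank 0)}
    {hdeg : ∀ i a b, U.d i a b ≠ 0 → deg i a ≤ deg (i + 1) b}
    {hdeg' : ∀ i a b, U.d i a b ≠ 0 →
      transportDegree hmem f i a ≤ transportDegree hmem f (i + 1) b}
    (h : U.IsPresentation (transportDegree hmem f) m' o)
    (hex : ∀ e, (U.toPosetGraded deg hdeg).ExactOn (Set.Iic e)) (e : τ →₀ ℕ) :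
    (U.toPosetGraded (transportDegree hmem f) hdeg').ExactOn (Set.Iic e) := by
  induction e using WellFoundedLT.induction with
  | ind e ih =>
    by_cases he : e ∈ bettiPoset k m'
    · have hiff : ∀ i v, transportDegree hmem f i v ∈ Set.Iic e ↔
          deg i v ∈ Set.Iic (f.symm ⟨e, he⟩ : σ →₀ ℕ) := fun i v =>
        (f.le_symm_apply (x := ⟨deg i v, hmem i v⟩) (y := ⟨e, he⟩)).symm
      have h1 := hex (f.symm ⟨e, he⟩)
      rw [toPosetGraded_exactOn_iff] at h1 ⊢
      simpa only [hiff] using h1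
    -- No basis element has degree `e`, so the strand lives strictly below `e`, where the induction
    -- hypothesis permits comparison with Taylor.
    · have hiff : ∀ i v, transportDegree hmem f i v ∈ Set.Iic e ↔
          transportDegree hmem f i v ∈ Set.Iio e := by
        intro i v
        have hv : transportDegree hmem f i v ≠ e := by
          rintro rfl
          exact he (transportDegree_mem i v)
        exact hv.le_iff_lt
      have h1 := h.exactOn_Iio (hdeg := hdeg') he ih
      rw [toPosetGraded_exactOn_iff] at h1 ⊢
      simpa only [hiff] using h1

/-- In a complex that is exact on all strands and has strictly increasing degrees, the degree of a
basis element is the lcm of the degrees of the basis elements in its boundary. -/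
theorem homogenizationDegree_eq {o : Fin (U.rank 0)} (h : U.IsPresentation deg m o)
    (hdeg : ∀ i a b, U.d i a b ≠ 0 → deg i a ≤ deg (i + 1) b)
    (hne : ∀ i a b, U.d i a b ≠ 0 → deg i a ≠ deg (i + 1) b)
    (hex : ∀ e, (U.toPosetGraded deg hdeg).ExactOn (Set.Iic e)) :
    ∀ i v, U.homogenizationDegree (deg 1) i v = deg i v
  | 0, v => by rw [h.eq_origin v, h.deg_origin, homogenizationDegree]
  | 1, v => by rw [homogenizationDegree]
  | i + 2, v => by
    classical
    have ih := homogenizationDegree_eq h hdeg hne hex (i + 1)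
    have hle : U.homogenizationDegree (deg 1) (i + 2) v ≤ deg (i + 2) v := by
      rw [homogenizationDegree]
      refine Finset.sup_le fun a ha => ?_
      rw [ih]
      exact hdeg _ _ _ (by simpa using ha)
    by_contra hv
    -- If the lcm were smaller than `deg v`, the boundary of `v` would already bound in the strand
    -- of the lcm, which excludes `v`.
    refine false_of_exactOn hne (J := Set.Iic (U.homogenizationDegree (deg 1) (i + 2) v))
      (Set.Iic_subset_Iic.2 hle) (fun hle' => hv (le_antisymm hle hle')) (hex _) (hex _)
      fun a ha => ?_
    rw [Set.mem_Iic, ← ih]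
    exact U.homogenizationDegree_le _ _ _ _ ha

end BasedComplex

/-- The `j`-th basis element of `F_1` has as multidegree a minimal generator of `M`, which lies in
the Betti poset; in the `N`-homogenization it gets the minimal generator of `N` that corresponds to
it under the isomorphism `f` of the Betti posets. -/
theorem mainTheorem9 {k : Type*} [Field k] {n l r s : ℕ}
    (M : Ideal (MvPolynomial (Fin n) k)) (N : Ideal (MvPolynomial (Fin l) k))
    (hM : M ≠ ⊤) (hN : N ≠ ⊤)
    (m : Fin r → (Fin n →₀ ℕ)) (m' : Fin s → (Fin l →₀ ℕ))
    (hm : IsMinimalMonomialGenerators M m) (hm' : IsMinimalMonomialGenerators N m')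
    (f : bettiPoset k m ≃o bettiPoset k m')
    (F : MultigradedComplex k (Fin n)) (hF : F.IsMinimalFreeResolution M) :
    ∃ h : ∀ j, F.mdeg 1 j ∈ bettiPoset k m,
      Function.Injective (fun j => (f ⟨F.mdeg 1 j, h j⟩ : Fin l →₀ ℕ)) ∧
      Set.range (fun j => (f ⟨F.mdeg 1 j, h j⟩ : Fin l →₀ ℕ)) = Set.range m' ∧
      (F.frame.homogenization
        (fun j => (f ⟨F.mdeg 1 j, h j⟩ : Fin l →₀ ℕ))).IsMinimalFreeResolution N := by
  have hU := hF.frame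
  obtain ⟨o, ho, hinj⟩ := hU.exists_isPresentation hM hm
  have hmem := hU.deg_mem_bettiPoset hM hm
  have ho' : F.frame.IsPresentation (BasedComplex.transportDegree hmem f) m' o :=
    ho.transport (hm.generator_ne_zero hM) (hm'.generator_ne_zero hN) hm.not_dvd hm'.not_dvd
  have hle : ∀ i a b, F.frame.d i a b ≠ 0 → BasedComplex.transportDegree hmem f i a ≤
      BasedComplex.transportDegree hmem f (i + 1) b := fun i a b h =>
    BasedComplex.transportDegree_le_iff.2 (hU.deg_le i a b h)
  have hne : ∀ i a b, F.frame.d i a b ≠ 0 → BasedComplex.transportDegree hmem f i a ≠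
      BasedComplex.transportDegree hmem f (i + 1) b := fun i a b h he =>
    hU.deg_ne i a b h (le_antisymm (hU.deg_le i a b h)
      (BasedComplex.transportDegree_le_iff.1 he.ge))
  have hex := BasedComplex.exactOn_Iic_transport (hdeg' := hle) ho' hU.exactOn_Iic
  -- The lcm rule reproduces the transported degrees in all homological degrees, so exactness can be
  -- checked on the latter.
  have hdeg : F.frame.homogenizationDegree (BasedComplex.transportDegree hmem f 1) =
      BasedComplex.transportDegree hmem f :=
    funext fun i => funext (BasedComplex.homogenizationDegree_eq ho' hle hne hex i)
  refine ⟨hmem 1, fun j j' h => ?_, ?_, ?_⟩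
  · exact hinj (congrArg Subtype.val (f.injective (Subtype.ext h)))
  · ext e
    constructor
    · rintro ⟨j, rfl⟩
      obtain ⟨i, hi⟩ := ho'.deg_one j
      exact ⟨i, hi.symm⟩
    · rintro ⟨i, rfl⟩
      exact ho'.exists_deg_one i
  · refine BasedComplex.IsMinimalResolution.homogenization
      (g := BasedComplex.transportDegree hmem f 1) ?_
    rw [hdeg]
    exact ho'.isMinimalResolution hm' hle hne hex
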